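/- A tropical curve $\Gamma$ is the geometric realization of a finite connected nonempty multigraph $G$ (loops allowed) with a length function $l : E(G) \to \mathbb{R}_{>0} \cup \{\infty\}$, each edge $e$ being identified with $[0, l(e)]$; $l(e) = \infty$ is allowed only on edges with a leaf end, in which case $[0,\infty]$ is the one-point compactification of $[0,\infty)$ and a leaf end of $e$ is identified with $\infty$ (a point at infinity). $\Gamma$ is regarded as a topological space with its path distance, with values in $[0,\infty]$ (a point at infinity has distance $\infty$ to every other point). A pair $(G,l)$ inducing this structure on $\Gamma$ is called a model for $\Gamma$; it is loopless if $G$ has no loops. A rational function on $\Gamma$ is either the constant function $-\infty$ or a continuous map $f : \Gamma \to \mathbb{R} \cup \{\pm\infty\}$ that is piecewise affine with integer slopes and finitely many pieces and takes the values $\pm\infty$ at most at points at infinity. $\operatorname{Rat}(\Gamma)$ denotes the set (semifield under pointwise maximum and addition, extended continuously to the points at infinity) of rational functions on $\Gamma$. A continuous map $\varphi : \Gamma \to \Gamma'$ between tropical curves is a finite harmonic morphism if there are loopless models $(G,l)$, $(G',l')$ for $\Gamma$, $\Gamma'$ such that (1) $\varphi(V(G)) \subset V(G')$; (2) $\varphi$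 maps each edge of $G$ onto an edge of $G'$; (3) for each $e \in E(G)$ there is a positive integer $\deg_e(\varphi)$ with $\operatorname{dist}(\varphi(x),\varphi(y)) = \deg_e(\varphi)\cdot \operatorname{dist}(x,y)$ for all $x,y \in e$; (4) for every $v \in V(G)$ the sum $\deg_v(\varphi) := \sum_{e \in E(G):\, e \mapsto e',\, v \in e} \deg_e(\varphi)$ does not depend on the edge $e'$ of $G'$ incident to $\varphi(v)$; and, in addition, $\Gamma'$ is a singleton if $\Gamma$ is one. Its degree is $\sum_{v \in V(G):\, v \mapsto v'} \deg_v(\varphi)$, for any $v' \in V(G')$; if $\Gamma$ and $\Gamma'$ are both singletons, $\varphi$ is regarded as having every number as its degree. The pull-back of $\operatorname{Rat}(\Gamma')$ by $\varphi$ is $\varphi^*(\operatorname{Rat}(\Gamma')) := \{ f' \circ \varphi \mid f' \in \operatorname{Rat}(\Gamma')\} \subset \operatorname{Rat}(\Gamma)$. Proposition. Let $\varphi_1 : \Gamma \to \Gamma_1'$ and $\varphi_2 : \Gamma \to \Gamma_2'$ be finite harmonic morphisms between tropical curves. Then the pull-backs $\varphi_1^*(\operatorname{Rat}(\Gamma_1'))$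 and $\varphi_2^*(\operatorname{Rat}(\Gamma_2'))$ coincide (as subsets of $\operatorname{Rat}(\Gamma)$) if and only if there exists a finite harmonic morphism $\varphi_{12} : \Gamma_2' \to \Gamma_1'$ of degree one such that $\varphi_1 = \varphi_{12} \circ \varphi_2$. -/

import Mathlib

open scoped ENNReal NNReal

universe u v w

/-- A presentation of a topological space `X` as the geometric realization of a finite multigraph
(loops allowed) with edge lengths in `(0, ∞]`.  Vertices are points of `X`; every edge `e` is
identified with the interval `[0, len e] ⊆ [0, ∞]` through `param e`, whose values outside of
`[0, len e]` play no role.  An edge of length `∞` is a leaf edge, and its end `∞` is a leaf end. -/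
structure Model (X : Type u) [TopologicalSpace X] where
  /-- The vertices. -/
  V : Finset X
  /-- The edges. -/
  E : Type
  fintypeE : Fintype E
  /-- The length function. -/
  len : E → ℝ≥0∞
  /-- The identification of an edge with `[0, len e]`. -/
  param : E → ℝ≥0∞ → X
  len_pos : ∀ e, 0 < len e
  continuousOn_param : ∀ e, ContinuousOn (param e) (Set.Iic (len e))
  param_zero_mem : ∀ e, param e 0 ∈ V
  param_len_mem : ∀ e, param e (len e) ∈ V
  interior_notMem : ∀ e t, 0 < t → t < len e → param e t ∉ V
  interior_inj : ∀ e t, 0 < t → t < len e → ∀ e' t', t' ≤ len e' →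
    param e' t' = param e t → e' = e ∧ t' = t
  leaf_of_len_eq_top : ∀ e, len e = ⊤ → ∀ e' t', t' ≤ len e' →
    param e' t' = param e ⊤ → e' = e ∧ t' = ⊤
  cover : ∀ x, x ∈ V ∨ ∃ e t, t ≤ len e ∧ param e t = x

namespace Model

attribute [instance] Model.fintypeE

variable {X : Type u} [TopologicalSpace X] (M : Model X)

/-- The closed subset of `X` corresponding to an edge. -/
def edge (e : M.E) : Set X := M.param e '' Set.Iic (M.len e)

/-- No edge is a loop. -/
def Loopless : Prop := ∀ e, M.param e 0 ≠ M.param e (M.len e)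

/-- `M.HasChain x y a`: the points `x` and `y` are joined by a finite chain of segments, each
contained in one edge, of total length `a`.  The length of the segment of an edge between the
parameters `s` and `t` is `|s - t| ∈ [0, ∞]`, where `|∞ - ∞| = 0` and `|∞ - t| = ∞` for
`t < ∞` (note that subtraction in `ℝ≥0∞` is truncated). -/
inductive HasChain : X → X → ℝ≥0∞ → Prop
  | nil (x : X) : HasChain x x 0
  | cons (e : M.E) (s t : ℝ≥0∞) (hs : s ≤ M.len e) (ht : t ≤ M.len e) (y : X) (a : ℝ≥0∞)
      (h : HasChain (M.param e t) y a) : HasChain (M.param e s) y (((s - t) + (t - s)) + a)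

/-- The path distance, with values in `[0, ∞]`. -/
noncomputable def pathDist (x y : X) : ℝ≥0∞ := sInf {a | M.HasChain x y a}

end Model

/-- A tropical curve: a connected nonempty Hausdorff space together with a distance with values in
`[0, ∞]`, both of which come from some finite graph with a length function.  (The topology is not
the one of the distance at the points at infinity.) -/
class TropicalCurve (Γ : Type u) extends TopologicalSpace Γ, EDist Γ where
  t2Space : T2Space Γ
  connectedSpace : ConnectedSpace Γ
  exists_model : ∃ M : Model Γ, ∀ x y : Γ, M.pathDist x y = edist x y

attribute [instance] TropicalCurve.t2Space TropicalCurve.connectedSpace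

/-- `M` is a model for the tropical curve `Γ`: it induces the distance of `Γ`. -/
def Model.IsModelFor {Γ : Type u} [TropicalCurve Γ] (M : Model Γ) : Prop :=
  ∀ x y : Γ, M.pathDist x y = edist x y

/-- The points at infinity of `Γ`. -/
def pointsAtInfinity (Γ : Type u) [TropicalCurve Γ] : Set Γ :=
  {x | ∃ M : Model Γ, M.IsModelFor ∧ ∃ e : M.E, M.len e = ⊤ ∧ M.param e ⊤ = x}

/-- The set of rational functions on `Γ`: the continuous functions to `[-∞, ∞]` that are infinite
at most at points at infinity and that are, on each edge of some model for `Γ`, affine with integer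
slope; and the constant function `-∞`. -/
def ratFunctions (Γ : Type u) [TropicalCurve Γ] : Set (Γ → EReal) :=
  {f | (Continuous f ∧
        (∀ x, x ∉ pointsAtInfinity Γ → f x ≠ ⊤ ∧ f x ≠ ⊥) ∧
        ∃ M : Model Γ, M.IsModelFor ∧ ∀ e : M.E, ∃ (m : ℤ) (c : ℝ), ∀ t : ℝ≥0,
          (t : ℝ≥0∞) ≤ M.len e → f (M.param e t) = ((c + m * t : ℝ) : EReal)) ∨
      f = fun _ => ⊥}

/-- Loopless models for `Γ` and `Γ'` and degrees of edges with respect to which the map `φ` is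
finite harmonic. -/
structure HarmonicModels {Γ : Type u} {Γ' : Type v} [TropicalCurve Γ] [TropicalCurve Γ']
    (φ : Γ → Γ') where
  /-- The model for the source. -/
  M : Model Γ
  /-- The model for the target. -/
  M' : Model Γ'
  isModelFor : M.IsModelFor
  isModelFor' : M'.IsModelFor
  loopless : M.Loopless
  loopless' : M'.Loopless
  map_vertex : ∀ x ∈ M.V, φ x ∈ M'.V
  /-- The image of an edge, which is an edge. -/
  edgeMap : M.E → M'.E
  image_edge : ∀ e, φ '' M.edge e = M'.edge (edgeMap e)
  /-- The degree of `φ` on an edge. -/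
  edgeDeg : M.E → ℕ
  edgeDeg_pos : ∀ e, 0 < edgeDeg e
  edist_map : ∀ e, ∀ x ∈ M.edge e, ∀ y ∈ M.edge e,
    edist (φ x) (φ y) = (edgeDeg e : ℝ≥0∞) * edist x y
  harmonic : ∀ x ∈ M.V, ∀ e₁ e₂ : M'.E, φ x ∈ M'.edge e₁ → φ x ∈ M'.edge e₂ →
    (open Classical in ∑ e with edgeMap e = e₁ ∧ x ∈ M.edge e, edgeDeg e) =
      (open Classical in ∑ e with edgeMap e = e₂ ∧ x ∈ M.edge e, edgeDeg e)

section

variable {Γ : Type u} {Γ' : Type v} [TropicalCurve Γ] [TropicalCurve Γ']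

/-- `φ` is a finite harmonic morphism.  A map from a one-point curve is one only if its target is
a one-point curve as well. -/
def IsFiniteHarmonic (φ : Γ → Γ') : Prop :=
  Continuous φ ∧ Nonempty (HarmonicModels φ) ∧ (Subsingleton Γ → Subsingleton Γ')

open Classical in
/-- `φ` is a finite harmonic morphism of degree `d`.  Here `vertexDeg x` is the degree of `φ` at
the vertex `x`, i.e. the common value of the sums in `HarmonicModels.harmonic`.  If both curves are
one-point spaces, then there are no such sums, and every `d` is a degree of `φ`. -/
def IsFiniteHarmonicOfDegree (φ : Γ → Γ') (d : ℕ) : Prop :=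
  IsFiniteHarmonic φ ∧ ∃ (H : HarmonicModels φ) (vertexDeg : Γ → ℕ),
    (∀ x ∈ H.M.V, ∀ e' : H.M'.E, φ x ∈ H.M'.edge e' →
      ∑ e with H.edgeMap e = e' ∧ x ∈ H.M.edge e, H.edgeDeg e = vertexDeg x) ∧
    ∀ y ∈ H.M'.V, ∑ x ∈ H.M.V with φ x = y, vertexDeg x = d

/-- The pull-back `φ^*(Rat(Γ'))` of the rational functions on `Γ'`, a set of functions on `Γ`. -/
def pullback (φ : Γ → Γ') : Set (Γ → EReal) := (fun f' => f' ∘ φ) '' ratFunctions Γ'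

end

/-! If the pull-backs agree, `φ₁` and `φ₂` have the same fibres, because rational functions separate
points (`exists_ratFunction_ne`). Finite harmonic morphisms are surjective, so by compactness `φ₁ =
Ψ ∘ φ₂` with `Ψ` a homeomorphism, and `Ψ` identifies the rational functions on the two targets.

It remains to see that rational functions determine the metric (`edist_map_le_of_ratFunctions`).
Near a finite point `p` the distance from `p` agrees with a rational function
(`exists_ratFunction_edist`), and any rational function vanishing at `p` is an integer multiple of
that distance, direction by direction (`eventually_eq_int_mul_edist`). Across `Ψ` the two distances
are therefore integer multiples of each other, hence equal: integrality of slopes forbids rescaling.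
Finite points go to finite points because a rational function can take the value `⊤` at any given
point at infinity. `edist_map_le_of_eventually` makes the local comparison global.

Finally, morphisms of degree one are isometric homeomorphisms
(`IsFiniteHarmonicOfDegree.exists_homeomorph`), and conversely when a loopless model exists
(`isFiniteHarmonicOfDegree_one_of_isometry`). Isometries preserve rational functions, which also
gives the other implication. -/

open Set Filter Topology

/-! ### Path distance and topology of a model -/

namespace Model

variable {X : Type u} [TopologicalSpace X] (M : Model X)

lemma HasChain.trans {M : Model X} {x y z : X} {a b : ℝ≥0∞} (h : M.HasChain x y a)
    (h' : M.HasChain y z b) : M.HasChain x z (a + b) := by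
  induction h with
  | nil x => simpa using h'
  | cons e s t hs ht y a _ ih =>
    rw [add_assoc]
    exact .cons e s t hs ht _ _ (ih h')

lemma HasChain.single (e : M.E) {s t : ℝ≥0∞} (hs : s ≤ M.len e) (ht : t ≤ M.len e) :
    M.HasChain (M.param e s) (M.param e t) ((s - t) + (t - s)) := by
  simpa using HasChain.cons e s t hs ht _ _ (.nil (M.param e t))

lemma HasChain.symm {M : Model X} {x y : X} {a : ℝ≥0∞} (h : M.HasChain x y a) :
    M.HasChain y x a := by
  induction h with
  | nil x => exact .nil x
  | cons e s t hs ht y a _ ih =>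
    rw [add_comm, add_comm (s - t)]
    exact ih.trans (.single M e ht hs)

lemma pathDist_self (x : X) : M.pathDist x x = 0 :=
  le_antisymm (sInf_le (HasChain.nil x)) zero_le

lemma pathDist_comm (x y : X) : M.pathDist x y = M.pathDist y x := by
  unfold pathDist
  congr 1
  ext a
  exact ⟨HasChain.symm, HasChain.symm⟩

lemma pathDist_triangle (x y z : X) : M.pathDist x z ≤ M.pathDist x y + M.pathDist y z := by
  unfold pathDist
  rw [ENNReal.sInf_add]
  refine le_iInf₂ fun a ha => ?_
  rw [add_comm, ENNReal.sInf_add]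
  refine le_iInf₂ fun b hb => ?_
  rw [add_comm]
  exact sInf_le (HasChain.trans ha hb)

lemma pathDist_param_le (e : M.E) {s t : ℝ≥0∞} (hs : s ≤ M.len e) (ht : t ≤ M.len e) :
    M.pathDist (M.param e s) (M.param e t) ≤ (s - t) + (t - s) :=
  sInf_le (.single M e hs ht)

/-- A pseudometric that is bounded by the length on each edge is bounded by the path distance. -/
lemma le_pathDist_of_le (d : X → X → ℝ≥0∞) (hself : ∀ x, d x x = 0)
    (htri : ∀ x y z, d x z ≤ d x y + d y z)
    (hd : ∀ e s t, s ≤ M.len e → t ≤ M.len e →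
      d (M.param e s) (M.param e t) ≤ (s - t) + (t - s)) (x y : X) :
    d x y ≤ M.pathDist x y := by
  refine le_sInf fun a ha => ?_
  induction ha with
  | nil x => exact (hself x).le
  | cons e s t hs ht y a _ ih => exact (htri _ _ _).trans (add_le_add (hd e s t hs ht) ih)

lemma isCompact_image_param (e : M.E) {s : Set ℝ≥0∞} (hs : IsClosed s) (h : s ⊆ Iic (M.len e)) :
    IsCompact (M.param e '' s) :=
  hs.isCompact.image_of_continuousOn ((M.continuousOn_param e).mono h)

lemma isClosed_edge [T2Space X] (e : M.E) : IsClosed (M.edge e) :=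
  (M.isCompact_image_param e isClosed_Iic subset_rfl).isClosed

lemma param_mem_edge (e : M.E) {t : ℝ≥0∞} (ht : t ≤ M.len e) : M.param e t ∈ M.edge e :=
  ⟨t, ht, rfl⟩

lemma eq_zero_or_eq_len (e : M.E) {t : ℝ≥0∞} (ht : t ≤ M.len e) (h : M.param e t ∈ M.V) :
    t = 0 ∨ t = M.len e := by
  by_contra! hc
  exact M.interior_notMem e t (pos_iff_ne_zero.2 hc.1) (lt_of_le_of_ne ht hc.2) h

lemma mem_edge_of_notMem (x : X) (h : x ∉ M.V) :
    ∃ e t, 0 < t ∧ t < M.len e ∧ M.param e t = x := by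
  obtain h' | ⟨e, t, ht, rfl⟩ := M.cover x
  · exact (h h').elim
  · refine ⟨e, t, pos_iff_ne_zero.2 ?_, lt_of_le_of_ne ht ?_, rfl⟩
    · rintro rfl; exact h (M.param_zero_mem e)
    · rintro rfl; exact h (M.param_len_mem e)

lemma eq_of_mem_edge {e e' : M.E} {x : X} (hx : x ∉ M.V) (h : x ∈ M.edge e) (h' : x ∈ M.edge e') :
    e' = e := by
  obtain ⟨t, ht, rfl⟩ := h
  obtain ⟨t', ht', h'⟩ := h'
  refine (M.interior_inj e t (pos_iff_ne_zero.2 ?_) (lt_of_le_of_ne ht ?_) e' t' ht' h').1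
  · rintro rfl; exact hx (M.param_zero_mem e)
  · rintro rfl; exact hx (M.param_len_mem e)

lemma compactSpace (M : Model X) : CompactSpace X := by
  constructor
  have : (univ : Set X) = ↑M.V ∪ ⋃ e, M.edge e := by
    ext x
    simp only [mem_univ, mem_union, Finset.mem_coe, mem_iUnion, true_iff]
    obtain h | ⟨e, t, ht, rfl⟩ := M.cover x
    · exact .inl h
    · exact .inr ⟨e, M.param_mem_edge e ht⟩
  rw [this]
  exact M.V.finite_toSet.isCompact.union
    (isCompact_iUnion fun e => M.isCompact_image_param e isClosed_Iic subset_rfl)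

/-- The preimage of a closed set is a finite set of vertices together with finitely many compact
pieces of edges. -/
lemma continuous_of_param [T2Space X] {Z : Type*} [TopologicalSpace Z] (f : X → Z)
    (h : ∀ e, ContinuousOn (fun t => f (M.param e t)) (Iic (M.len e))) : Continuous f := by
  refine continuous_iff_isClosed.2 fun C hC => ?_
  have : f ⁻¹' C = (↑M.V ∩ f ⁻¹' C) ∪
      ⋃ e, M.param e '' (Iic (M.len e) ∩ (fun t => f (M.param e t)) ⁻¹' C) := by
    ext x
    simp only [mem_preimage, mem_union, mem_inter_iff, Finset.mem_coe, mem_iUnion]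
    constructor
    · intro hx
      obtain h | ⟨e, t, ht, rfl⟩ := M.cover x
      · exact .inl ⟨h, hx⟩
      · exact .inr ⟨e, t, ⟨ht, hx⟩, rfl⟩
    · rintro (⟨-, hx⟩ | ⟨e, t, ⟨-, hx⟩, rfl⟩)
      · exact hx
      · exact hx
  rw [this]
  refine ((M.V.finite_toSet.subset inter_subset_left).isClosed).union
    (isClosed_iUnion_of_finite fun e => ?_)
  exact (M.isCompact_image_param e ((h e).preimage_isClosed_of_isClosed isClosed_Iic hC)
    inter_subset_left).isClosed

/-- A point on no edge would be isolated, its complement being a finite union of closed sets. -/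
lemma exists_mem_edge [T2Space X] [ConnectedSpace X] [Nontrivial X] (x : X) :
    ∃ e, x ∈ M.edge e := by
  by_contra! hc
  have h1 : IsClosed ({x}ᶜ : Set X) := by
    have : ({x}ᶜ : Set X) = (↑M.V \ {x}) ∪ ⋃ e, M.edge e := by
      ext y
      simp only [mem_compl_iff, mem_singleton_iff, mem_union, Set.mem_sdiff, Finset.mem_coe, mem_iUnion]
      constructor
      · intro hy
        obtain h | ⟨e, t, ht, rfl⟩ := M.cover y
        · exact .inl ⟨h, hy⟩
        · exact .inr ⟨e, M.param_mem_edge e ht⟩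
      · rintro (h | ⟨e, he⟩)
        · exact h.2
        · rintro rfl; exact hc e he
    rw [this]
    exact ((M.V.finite_toSet.subset sdiff_subset).isClosed).union
      (isClosed_iUnion_of_finite fun e => M.isClosed_edge e)
  have h2 : IsClopen ({x} : Set X) := ⟨isClosed_singleton, isClosed_compl_iff.1 h1⟩
  obtain h | h := isClopen_iff.1 h2
  · exact (singleton_ne_empty x) h
  · obtain ⟨y, hy⟩ := exists_ne x
    exact hy (h ▸ mem_univ y : y ∈ ({x} : Set X))

end Model

/-! ### The distance of a tropical curve and its points at infinity -/

namespace TropicalCurve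

variable {Γ : Type u} [TropicalCurve Γ]

lemma edist_self (x : Γ) : edist x x = 0 := by
  obtain ⟨M, hM⟩ := exists_model (Γ := Γ)
  rw [← hM, M.pathDist_self]

lemma edist_comm (x y : Γ) : edist x y = edist y x := by
  obtain ⟨M, hM⟩ := exists_model (Γ := Γ)
  rw [← hM, M.pathDist_comm, hM]

lemma edist_triangle (x y z : Γ) : edist x z ≤ edist x y + edist y z := by
  obtain ⟨M, hM⟩ := exists_model (Γ := Γ)
  simp only [← hM]
  exact M.pathDist_triangle x y z

instance : CompactSpace Γ := by
  obtain ⟨M, -⟩ := exists_model (Γ := Γ)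
  exact M.compactSpace

end TropicalCurve

namespace Model

variable {X : Type u} [TropicalCurve X] {M : Model X}

lemma IsModelFor.edist_param_le (hM : M.IsModelFor) (e : M.E) {s t : ℝ≥0∞} (hs : s ≤ M.len e)
    (ht : t ≤ M.len e) : edist (M.param e s) (M.param e t) ≤ (s - t) + (t - s) := by
  rw [← hM]
  exact M.pathDist_param_le e hs ht

/-- The end `∞` is a leaf end, so a chain arriving there from elsewhere contains a segment of `e`
from a finite parameter to `⊤`, of length `⊤`. -/
lemma IsModelFor.edist_param_top (hM : M.IsModelFor) {e : M.E} (he : M.len e = ⊤) {z : X}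
    (hz : z ≠ M.param e ⊤) : edist z (M.param e ⊤) = ⊤ := by
  rw [← hM]
  refine sInf_eq_top.2 fun a ha => ?_
  change M.HasChain _ _ _ at ha
  generalize hp : M.param e ⊤ = p at ha hz
  induction ha with
  | nil => exact (hz rfl).elim
  | cons e' s t hs ht y a _ ih =>
    subst hp
    by_cases h : M.param e' t = M.param e ⊤
    · obtain ⟨rfl, rfl⟩ := M.leaf_of_len_eq_top e he e' t ht h
      have : s ≠ ⊤ := by rintro rfl; exact hz rfl
      simp [ENNReal.top_sub this]
    · simp [ih rfl h]

/-- Another point of the same edge is at finite distance, whereas a point at infinity, in whichever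
model it is witnessed, is infinitely far from all others. -/
lemma IsModelFor.param_notMem_pointsAtInfinity (hM : M.IsModelFor) (e : M.E) {t : ℝ≥0∞}
    (ht : t ≤ M.len e) (ht' : t ≠ ⊤) : M.param e t ∉ pointsAtInfinity X := by
  rintro ⟨M₀, hM₀, e₀, he₀, h⟩
  obtain ⟨s, hs0, hs1, hst⟩ : ∃ s, 0 < s ∧ s < M.len e ∧ s ≠ t := by
    obtain ⟨s, hs0, hs1⟩ := exists_between (M.len_pos e)
    by_cases h : s = t
    · obtain ⟨r, hr0, hr1⟩ := exists_between hs0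
      exact ⟨r, hr0, hr1.trans hs1, h ▸ hr1.ne⟩
    · exact ⟨s, hs0, hs1, h⟩
  have h1 : M.param e s ≠ M₀.param e₀ ⊤ := fun h' =>
    hst (M.interior_inj e s hs0 hs1 e t ht (h.symm.trans h'.symm)).2.symm
  have h2 := hM₀.edist_param_top he₀ h1
  have h3 := hM.edist_param_le e hs1.le ht
  rw [← h, h2, top_le_iff, ENNReal.add_eq_top] at h3
  obtain h3 | h3 := h3
  · exact (lt_of_le_of_lt tsub_le_self (hs1.trans_le le_top)).ne h3
  · exact (lt_of_le_of_lt tsub_le_self ht'.lt_top).ne h3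

end Model

/-! ### Subdivision of models -/

namespace Model

section subdivide

variable {X : Type u} [TopologicalSpace X] (M : Model X)

open Classical in
/-- The subdivision of a model at the point with parameter `a` of the edge `e₀`. -/
noncomputable def subdivide (e₀ : M.E) (a : ℝ≥0∞) (ha0 : 0 < a) (ha : a < M.len e₀) : Model X where
  V := insert (M.param e₀ a) M.V
  E := Option M.E
  fintypeE := inferInstance
  len
    | none => M.len e₀ - a
    | some e => if e = e₀ then a else M.len e
  param
    | none => fun t => M.param e₀ (a + t)
    | some e => M.param e
  len_pos
    | none => tsub_pos_of_lt ha
    | some e => by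
      dsimp only
      split_ifs
      exacts [ha0, M.len_pos e]
  continuousOn_param
    | none => by
      refine (M.continuousOn_param e₀).comp (by fun_prop) fun t ht => ?_
      exact (add_le_add_right ht a).trans (add_tsub_cancel_of_le ha.le).le
    | some e => by
      refine (M.continuousOn_param e).mono (Iic_subset_Iic.2 ?_)
      dsimp only
      split_ifs with h
      exacts [h ▸ ha.le, le_rfl]
  param_zero_mem
    | none => by simp
    | some e => by simp [M.param_zero_mem]
  param_len_mem
    | none => by simp [add_tsub_cancel_of_le ha.le, M.param_len_mem]
    | some e => by
      dsimp only
      split_ifs with h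
      · subst h; simp
      · simp [M.param_len_mem]
  interior_notMem
    | none => fun t h0 h1 => by
      have h2 : a + t < M.len e₀ := by rwa [add_comm, ← lt_tsub_iff_right]
      rw [Finset.mem_insert, not_or]
      refine ⟨fun h => ?_, M.interior_notMem _ _ (ha0.trans_le le_self_add) h2⟩
      have h3 := (M.interior_inj e₀ a ha0 ha _ _ h2.le h).2
      exact (ENNReal.lt_add_right ha.ne_top h0.ne').ne' h3
    | some e => fun t h0 h1 => by
      dsimp only at h1
      rw [Finset.mem_insert, not_or]
      split_ifs at h1 with he
      · subst he
        refine ⟨fun h => ?_, M.interior_notMem _ _ h0 (h1.trans ha)⟩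
        exact h1.ne (M.interior_inj e a ha0 ha _ _ (h1.trans ha).le h).2
      · refine ⟨fun h => ?_, M.interior_notMem _ _ h0 h1⟩
        exact he (M.interior_inj e₀ a ha0 ha _ _ h1.le h).1
  interior_inj e t h0 h1 e' t' h' h := by
    match e, e' with
    | none, none =>
      have h2 : a + t < M.len e₀ := by rwa [add_comm, ← lt_tsub_iff_right]
      have h3 : a + t' ≤ M.len e₀ :=
        (add_le_add_right h' a).trans (add_tsub_cancel_of_le ha.le).le
      have := (M.interior_inj e₀ _ (ha0.trans_le le_self_add) h2 _ _ h3 h).2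
      exact ⟨rfl, (ENNReal.add_right_inj ha.ne_top).1 this⟩
    | none, some e' =>
      have h2 : a + t < M.len e₀ := by rwa [add_comm, ← lt_tsub_iff_right]
      have h3 : t' ≤ M.len e' := by
        dsimp only at h'
        split_ifs at h' with he
        exacts [he ▸ h'.trans ha.le, h']
      obtain ⟨rfl, rfl⟩ := M.interior_inj e₀ _ (ha0.trans_le le_self_add) h2 _ _ h3 h
      simp only [if_true] at h'
      exact ((ENNReal.lt_add_right ha.ne_top h0.ne').not_ge h').elim
    | some e, none =>
      have h3 : a + t' ≤ M.len e₀ :=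
        (add_le_add_right h' a).trans (add_tsub_cancel_of_le ha.le).le
      have h2 : t < M.len e := by
        dsimp only at h1
        split_ifs at h1 with he
        exacts [he ▸ h1.trans ha, h1]
      obtain ⟨rfl, rfl⟩ := M.interior_inj e _ h0 h2 _ _ h3 h
      simp only [if_true] at h1
      exact (h1.not_ge le_self_add).elim
    | some e, some e' =>
      have h2 : t < M.len e := by
        dsimp only at h1
        split_ifs at h1 with he
        exacts [he ▸ h1.trans ha, h1]
      have h3 : t' ≤ M.len e' := by
        dsimp only at h'
        split_ifs at h' with he
        exacts [he ▸ h'.trans ha.le, h']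
      obtain ⟨rfl, rfl⟩ := M.interior_inj e _ h0 h2 _ _ h3 h
      exact ⟨rfl, rfl⟩
  leaf_of_len_eq_top e he e' t' h' h := by
    match e, e' with
    | none, none =>
      have h1 : M.len e₀ = ⊤ := ((ENNReal.sub_eq_top_iff).1 he).1
      dsimp only at h
      rw [add_top] at h
      have := (M.leaf_of_len_eq_top e₀ h1 _ _ (h1 ▸ le_top) h).2
      rw [ENNReal.add_eq_top] at this
      exact ⟨rfl, this.resolve_left ha.ne_top⟩
    | none, some e' =>
      have h1 : M.len e₀ = ⊤ := ((ENNReal.sub_eq_top_iff).1 he).1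
      have h3 : t' ≤ M.len e' := by
        dsimp only at h'
        split_ifs at h' with he
        exacts [he ▸ h'.trans ha.le, h']
      dsimp only at h
      rw [add_top] at h
      obtain ⟨rfl, rfl⟩ := M.leaf_of_len_eq_top e₀ h1 _ _ h3 h
      simp only [if_true] at h'
      exact (ha.ne_top (top_le_iff.1 h')).elim
    | some e, none =>
      dsimp only at he
      split_ifs at he with hee
      · exact (ha.ne_top he).elim
      · have h3 : a + t' ≤ M.len e₀ :=
          (add_le_add_right h' a).trans (add_tsub_cancel_of_le ha.le).le
        exact (hee (M.leaf_of_len_eq_top e he _ _ h3 h).1.symm).elim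
    | some e, some e' =>
      dsimp only at he
      split_ifs at he with hee
      · exact (ha.ne_top he).elim
      · have h3 : t' ≤ M.len e' := by
          dsimp only at h'
          split_ifs at h' with he
          exacts [he ▸ h'.trans ha.le, h']
        obtain ⟨rfl, rfl⟩ := M.leaf_of_len_eq_top e he _ _ h3 h
        exact ⟨rfl, rfl⟩
  cover x := by
    obtain h | ⟨e, t, ht, rfl⟩ := M.cover x
    · exact .inl (Finset.mem_insert_of_mem h)
    · by_cases he : e = e₀
      · subst he
        obtain h | h := le_total t a
        · exact .inr ⟨some e, t, by simpa using h, rfl⟩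
        · refine .inr ⟨none, t - a, tsub_le_tsub_right ht a, ?_⟩
          dsimp only
          rw [add_tsub_cancel_of_le h]
      · exact .inr ⟨some e, t, by simpa [he] using ht, rfl⟩

/-- Each inequality need only be checked on single edges of one of the models. The one substantial
case is a segment of `e₀` that crosses the new vertex; it is split there. -/
lemma pathDist_subdivide (e₀ : M.E) (a : ℝ≥0∞) (ha0 : 0 < a) (ha : a < M.len e₀) (x y : X) :
    (M.subdivide e₀ a ha0 ha).pathDist x y = M.pathDist x y := by
  set M' := M.subdivide e₀ a ha0 ha with hM'
  have hnone : ∀ t, a ≤ t → t ≤ M.len e₀ →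
      t - a ≤ M'.len none ∧ M'.param none (t - a) = M.param e₀ t := fun t h1 h2 =>
    ⟨tsub_le_tsub_right h2 a, congrArg (M.param e₀) (add_tsub_cancel_of_le h1)⟩
  have hsome : M'.len (some e₀) = a := if_pos rfl
  apply le_antisymm
  · refine M.le_pathDist_of_le _ M'.pathDist_self M'.pathDist_triangle (fun e s t hs ht => ?_) x y
    by_cases he : e = e₀
    · subst he
      have main : ∀ s t, s ≤ t → t ≤ M.len e →
          M'.pathDist (M.param e s) (M.param e t) ≤ t - s := by
        intro s t hst ht
        have hlow : ∀ s t, s ≤ t → t ≤ a → M'.pathDist (M.param e s) (M.param e t) ≤ t - s := by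
          intro s t hst ht
          have := M'.pathDist_param_le (some e) (hsome ▸ hst.trans ht) (hsome ▸ ht)
          rwa [tsub_eq_zero_of_le hst, zero_add] at this
        have hhigh : ∀ s t, a ≤ s → s ≤ t → t ≤ M.len e →
            M'.pathDist (M.param e s) (M.param e t) ≤ t - s := by
          intro s t has hst ht
          obtain ⟨h1, h2⟩ := hnone s has (hst.trans ht)
          obtain ⟨h3, h4⟩ := hnone t (has.trans hst) ht
          have := M'.pathDist_param_le none h1 h3
          rw [h2, h4, tsub_eq_zero_of_le (tsub_le_tsub_right hst a), zero_add] at this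
          refine this.trans (tsub_le_iff_right.2 ?_)
          rw [tsub_add_tsub_cancel hst has]
        rcases le_total t a with h1 | h1
        · exact hlow s t hst h1
        rcases le_total a s with h2 | h2
        · exact hhigh s t h2 hst ht
        calc _ ≤ _ := M'.pathDist_triangle _ (M.param e a) _
          _ ≤ (a - s) + (t - a) := add_le_add (hlow s a h2 le_rfl) (hhigh a t le_rfl h1 ht)
          _ = t - s := by rw [add_comm, tsub_add_tsub_cancel h1 h2]
      rcases le_total s t with h | h
      · exact (main s t h ht).trans le_add_self
      · rw [M'.pathDist_comm]
        exact (main t s h hs).trans le_self_add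
    · have hlen : M'.len (some e) = M.len e := if_neg he
      exact M'.pathDist_param_le (some e) (hlen ▸ hs) (hlen ▸ ht)
  · refine M'.le_pathDist_of_le _ M.pathDist_self M.pathDist_triangle (fun e s t hs ht => ?_) x y
    match e with
    | none =>
      have h : ∀ s, s ≤ M'.len none → a + s ≤ M.len e₀ := fun s hs =>
        (add_le_add_right hs a).trans (add_tsub_cancel_of_le ha.le).le
      have := M.pathDist_param_le e₀ (h s hs) (h t ht)
      rwa [ENNReal.add_sub_add_eq_sub_left ha.ne_top, ENNReal.add_sub_add_eq_sub_left ha.ne_top] at this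
    | some e =>
      have h : M'.len (some e) ≤ M.len e := by
        by_cases he : e = e₀
        · subst he; exact hsome ▸ ha.le
        · exact (if_neg he).le
      exact M.pathDist_param_le e (hs.trans h) (ht.trans h)

/-- `M'` is a subdivision of `M`, with orientations preserved. -/
def Refines (M' M : Model X) : Prop :=
  M.V ⊆ M'.V ∧ ∀ e', ∃ e a, a ≠ ⊤ ∧ a + M'.len e' ≤ M.len e ∧
    ∀ t, M'.param e' t = M.param e (a + t)

lemma Refines.refl : M.Refines M :=
  ⟨subset_rfl, fun e => ⟨e, 0, by simp, by simp, by simp⟩⟩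

variable {M}

lemma Refines.trans {M' M'' : Model X} (h : M''.Refines M') (h' : M'.Refines M) :
    M''.Refines M := by
  refine ⟨h'.1.trans h.1, fun e'' => ?_⟩
  obtain ⟨e', a', ha', hl', hp'⟩ := h.2 e''
  obtain ⟨e, a, ha, hl, hp⟩ := h'.2 e'
  refine ⟨e, a + a', by simp [ha, ha'], ?_, fun t => ?_⟩
  · rw [add_assoc]
    exact (add_le_add_right hl' a).trans hl
  · rw [hp', hp, add_assoc]

lemma refines_subdivide (e₀ : M.E) (a : ℝ≥0∞) (ha0 : 0 < a) (ha : a < M.len e₀) :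
    (M.subdivide e₀ a ha0 ha).Refines M := by
  classical
  refine ⟨Finset.subset_insert _ _, fun e' => ?_⟩
  match e' with
  | none => exact ⟨e₀, a, ha.ne_top, (add_tsub_cancel_of_le ha.le).le, fun t => rfl⟩
  | some e =>
    refine ⟨e, 0, by simp, ?_, fun t => by rw [zero_add]; rfl⟩
    rw [zero_add]
    by_cases he : e = e₀
    · subst he; exact (if_pos rfl).trans_le ha.le
    · exact (if_neg he).le

lemma exists_refines (M : Model X) (S : Finset X) :
    ∃ M' : Model X, M'.Refines M ∧ S ⊆ M'.V ∧ ∀ x y, M'.pathDist x y = M.pathDist x y := by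
  classical
  induction S using Finset.induction_on with
  | empty => exact ⟨M, .refl M, by simp, fun _ _ => rfl⟩
  | insert p S _ ih =>
    obtain ⟨M', h1, h2, h3⟩ := ih
    by_cases hp : p ∈ M'.V
    · exact ⟨M', h1, Finset.insert_subset hp h2, h3⟩
    · obtain ⟨e, t, h0, ht, rfl⟩ := M'.mem_edge_of_notMem p hp
      refine ⟨M'.subdivide e t h0 ht, (refines_subdivide e t h0 ht).trans h1,
        Finset.insert_subset (Finset.mem_insert_self _ _) (h2.trans (Finset.subset_insert _ _)),
        fun x y => ?_⟩
      rw [pathDist_subdivide, h3]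

end subdivide

end Model

/-! ### The distance from a vertex -/

namespace Model

section star

variable {X : Type u} [TropicalCurve X] {M : Model X} {p : X} {c : ℝ≥0∞}

open Classical in
/-- The distance from the vertex `p` to the point with parameter `t` of the edge `e`, truncated
at `c`, for `c` at most half the length of every edge. -/
noncomputable def starDist (M : Model X) (p : X) (c : ℝ≥0∞) (e : M.E) (t : ℝ≥0∞) : ℝ≥0∞ :=
  min c (min (if M.param e 0 = p then t else ⊤)
    (if M.param e (M.len e) = p then M.len e - t else ⊤))

open Classical in
lemma starDist_of_mem_V (hc : ∀ e, c ≤ M.len e) (e : M.E) {t : ℝ≥0∞} (ht : t ≤ M.len e)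
    (h : M.param e t ∈ M.V) : M.starDist p c e t = if M.param e t = p then 0 else c := by
  unfold starDist
  obtain rfl | rfl := M.eq_zero_or_eq_len e ht h
  · by_cases h0 : M.param e 0 = p
    · simp [h0]
    · simp only [h0, if_false, tsub_zero]
      split_ifs <;> simp [hc e]
  · by_cases h0 : M.param e (M.len e) = p
    · simp [h0]
    · simp only [h0, if_false]
      split_ifs <;> simp [hc e]

/-- Distinct parameters give the same point only at vertices, where the value depends on the point
alone. So `starDist` descends to a function on `X`. -/
lemma starDist_congr (hc : ∀ e, c ≤ M.len e) {e e' : M.E} {t t' : ℝ≥0∞} (ht : t ≤ M.len e)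
    (ht' : t' ≤ M.len e') (h : M.param e t = M.param e' t') :
    M.starDist p c e t = M.starDist p c e' t' := by
  by_cases hV : M.param e t ∈ M.V
  · rw [starDist_of_mem_V hc e ht hV, starDist_of_mem_V hc e' ht' (h ▸ hV), h]
  · obtain ⟨rfl, rfl⟩ := M.interior_inj e t
      (pos_iff_ne_zero.2 fun h0 => hV (h0 ▸ M.param_zero_mem e))
      (lt_of_le_of_ne ht fun h0 => hV (h0 ▸ M.param_len_mem e)) e' t' ht' h.symm
    rfl

lemma starDist_le (e : M.E) (s t : ℝ≥0∞) :
    M.starDist p c e s ≤ M.starDist p c e t + ((s - t) + (t - s)) := by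
  unfold starDist
  rw [min_add, min_add]
  refine min_le_min le_self_add (min_le_min ?_ ?_)
  · split_ifs
    · rw [← add_assoc]
      exact le_add_tsub.trans le_self_add
    · simp
  · split_ifs
    · calc M.len e - s ≤ (M.len e - t) + (t - s) := tsub_le_tsub_add_tsub
        _ ≤ _ := add_le_add_right le_add_self _
    · simp

open Classical in
lemma starDist_of_le {e : M.E} {s : ℝ≥0∞} (h : s ≤ c) (h' : c ≤ M.len e - s) :
    M.starDist p c e s = if M.param e 0 = p then s else c := by
  unfold starDist
  split_ifs <;> simp [h, h', h.trans h']

lemma starDist_eq_right {e : M.E} {s : ℝ≥0∞} (h : c ≤ s) (h' : c ≤ M.len e - s) :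
    M.starDist p c e s = c := by
  unfold starDist
  split_ifs <;> simp [h, h']

open Classical in
lemma starDist_of_sub_le {e : M.E} {s : ℝ≥0∞} (h : c ≤ s) (h' : M.len e - s ≤ c) :
    M.starDist p c e s = if M.param e (M.len e) = p then M.len e - s else c := by
  unfold starDist
  split_ifs <;> simp [h, h', le_trans h' h]

/-- Segments running directly to `p` give the upper bound. For the lower bound, `starDist` is well
defined on points, vanishes at `p` and is 1-Lipschitz on each edge, so it is bounded by the length
of any chain to `p`. -/
lemma IsModelFor.min_edist_param (hM : M.IsModelFor) (hp : p ∈ M.V) (hc : ∀ e, c ≤ M.len e)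
    (e : M.E) {t : ℝ≥0∞} (ht : t ≤ M.len e) :
    min (edist (M.param e t) p) c = M.starDist p c e t := by
  apply le_antisymm
  · refine le_min (min_le_right _ _) (le_min ?_ ?_)
    · split_ifs with h
      · have := hM.edist_param_le e ht zero_le
        rw [h, tsub_zero, zero_tsub, add_zero] at this
        exact (min_le_left _ _).trans this
      · exact le_top
    · split_ifs with h
      · have := hM.edist_param_le e ht le_rfl
        rw [h, tsub_eq_zero_of_le ht, zero_add] at this
        exact (min_le_left _ _).trans this
      · exact le_top
  · refine le_min ?_ (min_le_left _ _)
    rw [← hM]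
    refine le_sInf fun a ha => ?_
    change M.HasChain _ _ _ at ha
    generalize hx : M.param e t = x at ha
    induction ha generalizing e t with
    | nil x =>
      subst hx
      rw [starDist_of_mem_V hc e ht hp, if_pos rfl]
    | cons e' s t' hs ht' y a _ ih =>
      rw [starDist_congr hc ht hs hx, add_comm]
      exact (starDist_le e' s t').trans (add_le_add_left (ih hp e' ht' rfl) _)

lemma IsModelFor.exists_param_eq_of_edist_lt (hM : M.IsModelFor) {z : X} (hz : edist z p < ⊤) :
    z = p ∨ ∃ e t, t ≤ M.len e ∧ M.param e t = z := by
  rw [← hM, pathDist, sInf_lt_iff] at hz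
  obtain ⟨a, ha, -⟩ := hz
  cases ha with
  | nil => exact .inl rfl
  | cons e s t hs => exact .inr ⟨e, s, hs, rfl⟩

/-- Points close to a vertex `p` lie on an edge with end `p`, where the distance from `p` is the
difference of parameters. -/
lemma IsModelFor.exists_param_of_edist_lt (hM : M.IsModelFor) (hp : p ∈ M.V)
    (hc : ∀ e, c ≤ M.len e) {z : X} (hz : edist z p < c) :
    z = p ∨ ∃ e t, t ≤ M.len e ∧ M.param e t = z ∧
      ((M.param e 0 = p ∧ edist z p = t) ∨
        (M.param e (M.len e) = p ∧ edist z p = M.len e - t)) := by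
  obtain h | ⟨e, t, ht, rfl⟩ := hM.exists_param_eq_of_edist_lt (hz.trans_le le_top)
  · exact .inl h
  · refine .inr ⟨e, t, ht, rfl, ?_⟩
    have h := hM.min_edist_param hp hc e ht
    rw [min_eq_left hz.le] at h
    unfold starDist at h
    rw [h, min_lt_iff, or_iff_right (lt_irrefl _)] at hz
    rw [min_eq_right hz.le] at h
    have hne := (hz.trans_le le_top).ne
    rw [h]
    split_ifs at hne ⊢ with h1 h2 h2
    · rcases min_choice t (M.len e - t) with h' | h'
      · exact .inl ⟨h1, h'⟩
      · exact .inr ⟨h2, h'⟩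
    · exact .inl ⟨h1, by simp⟩
    · exact .inr ⟨h2, by simp⟩
    · simp at hne

/-- The factor 2 keeps the parameters `c` and `len e - c` in this order on each edge. Without edges
the infimum below is `⊤`, which is still positive. -/
lemma exists_two_mul_le_len (M : Model X) : ∃ c : ℝ≥0, 0 < c ∧ ∀ e, 2 * (c : ℝ≥0∞) ≤ M.len e := by
  have : 0 < Finset.univ.inf M.len := by
    rw [Finset.lt_inf_iff (by simp)]
    exact fun e _ => M.len_pos e
  obtain ⟨d, h0, hd⟩ := ENNReal.lt_iff_exists_nnreal_btwn.1 this
  refine ⟨d / 2, by simpa using h0, fun e => ?_⟩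
  calc 2 * ((d / 2 : ℝ≥0) : ℝ≥0∞) = d := by
        rw [← ENNReal.coe_ofNat, ← ENNReal.coe_mul, mul_div_cancel₀ d two_ne_zero]
    _ ≤ M.len e := hd.le.trans (Finset.inf_le (Finset.mem_univ e))

lemma exists_mem_V (p : X) : ∃ M : Model X, M.IsModelFor ∧ p ∈ M.V := by
  obtain ⟨M, hM⟩ := TropicalCurve.exists_model (Γ := X)
  obtain ⟨M', -, h, hd⟩ := M.exists_refines {p}
  exact ⟨M', fun x y => (hd x y).trans (hM x y), h (by simp)⟩

lemma eq_of_edist_eq_zero {z : X} (h : edist z p = 0) : z = p := by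
  obtain ⟨M, hM, hp⟩ := exists_mem_V p
  by_contra hz
  obtain ⟨c, hc0, hc⟩ := M.exists_two_mul_le_len
  have hc' : ∀ e, (c : ℝ≥0∞) ≤ M.len e := fun e => le_trans (by rw [two_mul]; simp) (hc e)
  obtain h | ⟨e, t, ht, rfl, ⟨h1, h2⟩ | ⟨h1, h2⟩⟩ :=
    hM.exists_param_of_edist_lt hp hc' (z := z) (by rw [h]; exact_mod_cast hc0)
  · exact hz h
  · rw [h] at h2
    subst h2
    exact hz h1
  · rw [h, eq_comm, tsub_eq_zero_iff_le] at h2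
    obtain rfl := le_antisymm ht h2
    exact hz h1

/-- Points at infinity are excluded because there the truncated distance jumps from `0` to `c`. -/
lemma IsModelFor.continuous_min_edist (hM : M.IsModelFor) (hp : p ∈ M.V)
    (hp' : ∀ e, M.len e = ⊤ → M.param e ⊤ ≠ p) (hc : ∀ e, c ≤ M.len e) :
    Continuous fun z => min (edist z p) c := by
  refine M.continuous_of_param _ fun e => ?_
  refine ContinuousOn.congr (f := M.starDist p c e) ?_ fun t ht => hM.min_edist_param hp hc e ht
  refine Continuous.continuousOn ?_
  unfold starDist
  refine continuous_const.min (Continuous.min ?_ ?_)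
  · split_ifs <;> fun_prop
  · split_ifs with h
    · exact ENNReal.continuous_sub_left fun h' => hp' e h' (h' ▸ h)
    · fun_prop

lemma eventually_edist_lt (hp : p ∉ pointsAtInfinity X) (hc : 0 < c) :
    ∀ᶠ z in 𝓝 p, edist z p < c := by
  obtain ⟨M, hM, hpV⟩ := exists_mem_V p
  obtain ⟨c', hc0, hc'⟩ := M.exists_two_mul_le_len
  have hle : ∀ e, (min c c' : ℝ≥0∞) ≤ M.len e := fun e =>
    (min_le_right _ _).trans (le_trans (by rw [two_mul]; simp) (hc' e))
  have hcont := hM.continuous_min_edist hpV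
    (fun e he h => hp ⟨M, hM, e, he, h⟩) hle
  have h0 : min (edist p p) (min c (c' : ℝ≥0∞)) < min c c' := by
    rw [TropicalCurve.edist_self]
    simp [hc, hc0]
  filter_upwards [hcont.continuousAt.eventually_lt_const h0] with z hz
  rw [min_lt_iff, or_iff_left (lt_irrefl _)] at hz
  exact hz.trans_le (min_le_left _ _)

end star

end Model

/-! ### Rational functions near a finite point -/

section rational

variable {X : Type u} [TropicalCurve X] {p : X}

/-- Near a finite zero `p`, a rational function is an integer multiple of the distance from `p`;
the multiple depends on the direction. -/
lemma eventually_eq_int_mul_edist (hp : p ∉ pointsAtInfinity X) {f : X → EReal}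
    (hf : f ∈ ratFunctions X) (h0 : f p = 0) :
    ∀ᶠ z in 𝓝 p, ∃ k : ℤ, f z = ((k * (edist z p).toReal : ℝ) : EReal) := by
  obtain ⟨-, -, M₀, hM₀, haff⟩ | rfl := hf
  swap
  · simp at h0
  obtain ⟨M, ⟨-, href⟩, hpV, hd⟩ := M₀.exists_refines {p}
  have hM : M.IsModelFor := fun x y => (hd x y).trans (hM₀ x y)
  replace hpV : p ∈ M.V := hpV (by simp)
  replace haff : ∀ e : M.E, ∃ (m : ℤ) (c : ℝ), ∀ t : ℝ≥0,
      (t : ℝ≥0∞) ≤ M.len e → f (M.param e t) = ((c + m * t : ℝ) : EReal) := by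
    -- An edge of the refinement is a piece of an old edge starting at `a`: the slope `m` persists
    -- and the constant becomes `c + m * a`.
    intro e
    obtain ⟨e₀, a, ha, hl, hpar⟩ := href e
    lift a to ℝ≥0 using ha
    obtain ⟨m, c, h⟩ := haff e₀
    refine ⟨m, c + m * a, fun t ht => ?_⟩
    rw [hpar, ← ENNReal.coe_add, h]
    · congr 1; push_cast; ring
    · rw [ENNReal.coe_add]
      exact (add_le_add_right ht _).trans hl
  obtain ⟨c, hc0, hc⟩ := M.exists_two_mul_le_len
  have hc' : ∀ e, (c : ℝ≥0∞) ≤ M.len e := fun e => le_trans (by rw [two_mul]; simp) (hc e)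
  filter_upwards [Model.eventually_edist_lt hp (c := c) (by exact_mod_cast hc0)] with z hz
  obtain rfl | ⟨e, t, ht, rfl, ⟨h1, h2⟩ | ⟨h1, h2⟩⟩ := hM.exists_param_of_edist_lt hpV hc' hz
  · exact ⟨0, by simp [h0]⟩
  · obtain ⟨m, b, h⟩ := haff e
    have h3 := h 0 (by simp)
    rw [ENNReal.coe_zero, h1, h0] at h3
    rw [h2] at hz
    lift t to ℝ≥0 using hz.ne_top
    refine ⟨m, ?_⟩
    rw [h2, h t ht]
    have : b = 0 := by
      simpa using EReal.coe_eq_zero.1 h3.symm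
    simp [this]
  · obtain ⟨m, b, h⟩ := haff e
    have hlen : M.len e ≠ ⊤ := fun h' => hp ⟨M, hM, e, h', h' ▸ h1⟩
    obtain ⟨l, hl⟩ := WithTop.ne_top_iff_exists.1 hlen
    change (l : ℝ≥0∞) = M.len e at hl
    rw [← hl] at h1 h2 ht h
    lift t to ℝ≥0 using (ht.trans_lt ENNReal.coe_lt_top).ne
    have h3 := h l le_rfl
    rw [h1, h0] at h3
    have h4 : b + m * l = 0 := EReal.coe_eq_zero.1 h3.symm
    -- The distance is measured from the right end, against the orientation of the edge.
    refine ⟨-m, ?_⟩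
    rw [h2, h t ht, ← ENNReal.coe_sub, ENNReal.coe_toReal, NNReal.coe_sub (by exact_mod_cast ht)]
    congr 1
    push_cast
    linarith

/-- The witness is the distance from `p` truncated at a small real `c`: truncation keeps it finite
and continuous, and piecewise affine with slopes `0` and `±1`. -/
lemma exists_ratFunction_edist (hp : p ∉ pointsAtInfinity X) :
    ∃ f ∈ ratFunctions X, f p = 0 ∧ (∀ z, f z = 0 → z = p) ∧
      ∀ᶠ z in 𝓝 p, f z = ((edist z p).toReal : EReal) := by
  obtain ⟨M, hM, hpV⟩ := Model.exists_mem_V p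
  have hp' : ∀ e, M.len e = ⊤ → M.param e ⊤ ≠ p := fun e he h => hp ⟨M, hM, e, he, h⟩
  obtain ⟨c, hc0, hc⟩ := M.exists_two_mul_le_len
  have hc' : ∀ e, (c : ℝ≥0∞) ≤ M.len e := fun e => le_trans (by rw [two_mul]; simp) (hc e)
  refine ⟨fun z => ((min (edist z p) c : ℝ≥0∞) : EReal), .inl ⟨?_, ?_, ?_⟩, ?_, ?_, ?_⟩
  · exact EReal.continuous_coe_ennreal_iff.2 (hM.continuous_min_edist hpV hp' hc')
  · exact fun x _ => ⟨by simp, by simp⟩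
  · classical
    -- On an edge, `starDist` can change slope only at the parameters `c` and `len e - c`, so these
    -- become vertices. Each new edge then lies before, between or after them.
    obtain ⟨M', ⟨-, href⟩, hV, hd⟩ := M.exists_refines
      (Finset.univ.image (fun e => M.param e c) ∪
        Finset.univ.image (fun e => M.param e (M.len e - c)))
    refine ⟨M', fun x y => (hd x y).trans (hM x y), fun e' => ?_⟩
    dsimp only
    obtain ⟨e, a, ha, hl', hpar⟩ := href e'
    lift a to ℝ≥0 using ha
    have hbreak : ∀ b : ℝ≥0∞, M.param e b ∈ M'.V → b ≤ a ∨ a + M'.len e' ≤ b := by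
      intro b hb
      by_contra! h
      have h1 : (a : ℝ≥0∞) + (b - a) = b := add_tsub_cancel_of_le h.1.le
      refine M'.interior_notMem e' (b - a) (tsub_pos_of_lt h.1) ?_ ?_
      · rw [ENNReal.sub_lt_iff_lt_left (by simp) h.1.le]
        exact h.2
      · rwa [hpar, h1]
    have hval : ∀ t : ℝ≥0, (t : ℝ≥0∞) ≤ M'.len e' →
        min (edist (M'.param e' t) p) c = M.starDist p c e (a + t) := fun t ht => by
      rw [hpar, hM.min_edist_param hpV hc' e ((add_le_add_right ht _).trans hl')]
    have hb1 := hbreak c (hV (by simp))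
    have hb2 := hbreak (M.len e - c) (hV (by simp))
    have hce : (c : ℝ≥0∞) ≤ M.len e - c := by
      refine ENNReal.le_sub_of_add_le_left (by simp) ?_
      rw [← two_mul]; exact hc e
    have hs : ∀ t : ℝ≥0, (t : ℝ≥0∞) ≤ M'.len e' → (a + t : ℝ≥0∞) ≤ a + M'.len e' := fun t ht =>
      add_le_add_right ht _
    by_cases h1 : (a : ℝ≥0∞) + M'.len e' ≤ c
    · have key : ∀ t : ℝ≥0, (t : ℝ≥0∞) ≤ M'.len e' →
          min (edist (M'.param e' t) p) c = if M.param e 0 = p then (a + t : ℝ≥0∞) else c := by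
        intro t ht
        have h2 := (hs t ht).trans h1
        rw [hval t ht, Model.starDist_of_le h2 (hce.trans (tsub_le_tsub_left h2 _))]
      by_cases h0 : M.param e 0 = p
      · refine ⟨1, a, fun t ht => ?_⟩
        rw [key t ht, if_pos h0, ← ENNReal.coe_add, EReal.coe_nnreal_eq_coe_real]
        simp
      · refine ⟨0, c, fun t ht => ?_⟩
        rw [key t ht, if_neg h0, EReal.coe_nnreal_eq_coe_real]
        simp
    replace hb1 := hb1.resolve_right h1
    by_cases h1 : (a : ℝ≥0∞) + M'.len e' ≤ M.len e - c
    · refine ⟨0, c, fun t ht => ?_⟩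
      have h2 : (c : ℝ≥0∞) ≤ M.len e - (a + t) := by
        refine ENNReal.le_sub_of_add_le_left (by simp) ?_
        exact add_le_of_le_tsub_right_of_le (hc' e) ((hs t ht).trans h1)
      rw [hval t ht, Model.starDist_eq_right (hb1.trans le_self_add) h2,
        EReal.coe_nnreal_eq_coe_real]
      simp
    replace hb2 := hb2.resolve_right h1
    -- The piece starts at a finite parameter beyond `len e - c`.
    have hlen : M.len e ≠ ⊤ := by
      intro h
      rw [h, ENNReal.top_sub (by simp), top_le_iff] at hb2
      simp at hb2
    have key : ∀ t : ℝ≥0, (t : ℝ≥0∞) ≤ M'.len e' → min (edist (M'.param e' t) p) c =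
        if M.param e (M.len e) = p then M.len e - (a + t : ℝ≥0∞) else c := by
      intro t ht
      rw [hval t ht, Model.starDist_of_sub_le (hb1.trans le_self_add)]
      exact (tsub_le_tsub_left (hb2.trans le_self_add) _).trans tsub_tsub_le
    by_cases h0 : M.param e (M.len e) = p
    · obtain ⟨l, hl⟩ := WithTop.ne_top_iff_exists.1 hlen
      change (l : ℝ≥0∞) = M.len e at hl
      refine ⟨-1, l - a, fun t ht => ?_⟩
      have h2 := (hs t ht).trans hl'
      rw [key t ht, if_pos h0]
      rw [← hl] at h2 ⊢
      rw [← ENNReal.coe_add] at h2 ⊢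
      rw [← ENNReal.coe_sub, EReal.coe_nnreal_eq_coe_real, NNReal.coe_sub (by exact_mod_cast h2)]
      congr 1
      push_cast
      ring
    · refine ⟨0, c, fun t ht => ?_⟩
      rw [key t ht, if_neg h0, EReal.coe_nnreal_eq_coe_real]
      simp
  · simp [TropicalCurve.edist_self]
  · intro z hz
    have : edist z p = 0 := by simpa [hc0.ne'] using hz
    exact Model.eq_of_edist_eq_zero this
  · filter_upwards [Model.eventually_edist_lt hp (c := c) (by exact_mod_cast hc0)] with z hz
    rw [min_eq_left hz.le]
    lift edist z p to ℝ≥0 using hz.ne_top with d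
    rfl

end rational

/-! ### Rational functions infinite at a point at infinity; separation of points -/

namespace Model

variable {X : Type u} [TopologicalSpace X] (M : Model X)

/-- An infinite edge is never a loop, since its end `∞` is a leaf end. -/
lemma param_injective_of_len_eq_top {e : M.E} (he : M.len e = ⊤) :
    Function.Injective (M.param e) := by
  have hle : ∀ t, t ≤ M.len e := fun t => he ▸ le_top
  have key : ∀ s t, 0 < s → M.param e t = M.param e s → t = s := by
    intro s t hs h
    by_cases hs' : s = ⊤
    · subst hs'
      exact (M.leaf_of_len_eq_top e he e t (hle t) h).2
    · exact (M.interior_inj e s hs (he ▸ Ne.lt_top hs') e t (hle t) h).2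
  intro s t h
  rcases eq_or_ne s 0 with rfl | hs
  · rcases eq_or_ne t 0 with rfl | ht
    · rfl
    · exact key _ _ (pos_iff_ne_zero.2 ht) h
  · exact (key _ _ (pos_iff_ne_zero.2 hs) h.symm).symm

/-- The parameter on an edge of infinite length, extended by zero to the other edges. -/
noncomputable def infiniteParam (e : M.E) (z : X) : ℝ≥0∞ := sSup {t | M.param e t = z}

lemma infiniteParam_param {e : M.E} (he : M.len e = ⊤) (t : ℝ≥0∞) :
    M.infiniteParam e (M.param e t) = t := by
  have : {s | M.param e s = M.param e t} = {t} := by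
    ext s
    exact (M.param_injective_of_len_eq_top he).eq_iff
  rw [infiniteParam, this, sSup_singleton]

/-- Another edge can meet `e` only at parameter `0`, so the supremum is over a subset of `{0}`,
possibly empty. -/
lemma infiniteParam_param_of_ne {e e' : M.E} (he : M.len e = ⊤) (h : e' ≠ e) {t : ℝ≥0∞}
    (ht : t ≤ M.len e') : M.infiniteParam e (M.param e' t) = 0 := by
  refine sSup_eq_bot.2 fun s hs => ?_
  by_contra h0
  by_cases hs' : s = ⊤
  · subst hs'
    exact h (M.leaf_of_len_eq_top e he e' t ht hs.symm).1
  · exact h (M.interior_inj e s (pos_iff_ne_zero.2 h0) (he ▸ Ne.lt_top hs') e' t ht hs.symm).1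

end Model

section

variable {X : Type u} [TropicalCurve X]

lemma Model.IsModelFor.exists_ratFunction_eq_top {M : Model X} (hM : M.IsModelFor) {e : M.E}
    (he : M.len e = ⊤) : ∃ f ∈ ratFunctions X, ∀ z, f z = ⊤ ↔ z = M.param e ⊤ := by
  have htop : ∀ z, M.infiniteParam e z = ⊤ ↔ z = M.param e ⊤ := by
    intro z
    constructor
    · intro h
      by_cases hz : ∃ t, M.param e t = z
      · obtain ⟨t, rfl⟩ := hz
        rw [M.infiniteParam_param he] at h
        rw [h]
      · have : {t | M.param e t = z} = ∅ := eq_empty_iff_forall_notMem.2 fun t ht => hz ⟨t, ht⟩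
        rw [infiniteParam, this, sSup_empty] at h
        simp at h
    · rintro rfl
      exact M.infiniteParam_param he ⊤
  refine ⟨fun z => (M.infiniteParam e z : EReal), .inl ⟨?_, fun x hx => ?_, M, hM, fun e' => ?_⟩,
    fun z => by simp [htop]⟩
  · refine EReal.continuous_coe_ennreal_iff.2 (M.continuous_of_param _ fun e' => ?_)
    by_cases h : e' = e
    · subst h
      exact continuousOn_id.congr fun t _ => M.infiniteParam_param he t
    · exact continuousOn_const.congr fun t ht => M.infiniteParam_param_of_ne he h ht
  · refine ⟨?_, by simp⟩
    simp only [ne_eq, EReal.coe_ennreal_eq_top_iff, htop]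
    rintro rfl
    exact hx ⟨M, hM, e, he, rfl⟩
  · by_cases h : e' = e
    · subst h
      refine ⟨1, 0, fun t _ => ?_⟩
      dsimp only
      rw [M.infiniteParam_param he, EReal.coe_nnreal_eq_coe_real]
      simp
    · exact ⟨0, 0, fun t ht => by simp [M.infiniteParam_param_of_ne he h ht]⟩

lemma notMem_pointsAtInfinity_of_ratFunction {f : X → EReal} (hf : f ∈ ratFunctions X)
    {x₀ : X} (hx₀ : f x₀ ≠ ⊥) {x : X} (hx : x ∉ pointsAtInfinity X) : f x ≠ ⊤ := by
  obtain ⟨-, h, -⟩ | rfl := hf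
  · exact (h x hx).1
  · exact (hx₀ rfl).elim

/-- Rational functions separate points. -/
lemma exists_ratFunction_ne {x y : X} (h : x ≠ y) : ∃ f ∈ ratFunctions X, f x ≠ f y := by
  by_cases hx : x ∈ pointsAtInfinity X
  · obtain ⟨M, hM, e, he, rfl⟩ := hx
    obtain ⟨f, hf, h'⟩ := hM.exists_ratFunction_eq_top he
    refine ⟨f, hf, fun hxy => h ((h' y).1 ?_).symm⟩
    rw [← hxy, h']
  · obtain ⟨f, hf, h0, h', -⟩ := exists_ratFunction_edist hx
    exact ⟨f, hf, fun hxy => h (h' y (hxy ▸ h0)).symm⟩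

end

/-! ### Rational functions determine the distance -/

section isometry

variable {X : Type u} {Y : Type v} [TropicalCurve X] [TropicalCurve Y]

/-- A map that does not increase distances from finite points locally does not increase
distances. -/
lemma edist_map_le_of_eventually (ψ : X → Y)
    (h : ∀ p, p ∉ pointsAtInfinity X → ∀ᶠ z in 𝓝 p, edist (ψ z) (ψ p) ≤ edist z p) (x y : X) :
    edist (ψ x) (ψ y) ≤ edist x y := by
  obtain ⟨M, hM⟩ : ∃ M : Model X, M.IsModelFor := TropicalCurve.exists_model
  rw [← hM]
  refine M.le_pathDist_of_le (fun x y => edist (ψ x) (ψ y))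
    (fun _ => TropicalCurve.edist_self _) (fun _ _ _ => TropicalCurve.edist_triangle _ _ _) ?_ x y
  intro e s t hs ht
  wlog hst : s ≤ t generalizing s t
  · rw [TropicalCurve.edist_comm, add_comm]
    exact this t s ht hs (le_of_not_ge hst)
  obtain rfl | hst' := hst.eq_or_lt
  · simp [TropicalCurve.edist_self]
  by_cases htop : t = ⊤
  · simp [htop, ENNReal.top_sub (htop ▸ hst').ne]
  lift t to ℝ≥0 using htop
  lift s to ℝ≥0 using (hst'.trans ENNReal.coe_lt_top).ne
  set γ : ℝ → X := fun r => M.param e (ENNReal.ofReal r) with hγ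
  have hmem : ∀ r ∈ Icc (s : ℝ) t, ENNReal.ofReal r ≤ M.len e := fun r hr =>
    (ENNReal.ofReal_le_ofReal hr.2).trans (by simpa using ht)
  have hcont : ContinuousOn γ (Icc (s : ℝ) t) :=
    (M.continuousOn_param e).comp ENNReal.continuous_ofReal.continuousOn hmem
  have hdist : ∀ r ∈ Icc (s : ℝ) t, ∀ r' ∈ Icc (s : ℝ) t,
      edist (γ r') (γ r) ≤ ENNReal.ofReal |r' - r| := by
    intro r hr r' hr'
    refine (hM.edist_param_le e (hmem r' hr') (hmem r hr)).trans ?_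
    rw [← ENNReal.ofReal_sub _ (s.coe_nonneg.trans hr.1),
      ← ENNReal.ofReal_sub _ (s.coe_nonneg.trans hr'.1)]
    rcases le_total r' r with h | h
    · rw [ENNReal.ofReal_of_nonpos (sub_nonpos.2 h), zero_add, abs_sub_comm,
        abs_of_nonneg (sub_nonneg.2 h)]
    · rw [ENNReal.ofReal_of_nonpos (sub_nonpos.2 h), add_zero, abs_of_nonneg (sub_nonneg.2 h)]
  have hloc : ∀ r ∈ Icc (s : ℝ) t, ∀ᶠ r' in 𝓝[Icc (s : ℝ) t] r,
      edist (ψ (γ r')) (ψ (γ r)) ≤ ENNReal.ofReal |r' - r| := by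
    intro r hr
    have h1 := h (γ r) (hM.param_notMem_pointsAtInfinity e (hmem r hr) ENNReal.ofReal_ne_top)
    filter_upwards [(hcont r hr).eventually h1, self_mem_nhdsWithin] with r' h2 h3
    exact h2.trans (hdist r hr r' h3)
  -- Continuous induction along the segment: `K` is relatively closed and extends to the right of
  -- each of its points.
  set K : Set ℝ := {r | edist (ψ (γ s)) (ψ (γ r)) ≤ ENNReal.ofReal (r - s)} with hK
  have hsub : Icc (s : ℝ) t ⊆ K := by
    refine IsClosed.Icc_subset_of_forall_mem_nhdsWithin ?_ ?_ ?_
    · refine isClosed_of_closure_subset fun r hr => ?_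
      have hr' : r ∈ Icc (s : ℝ) t := closure_minimal inter_subset_right isClosed_Icc hr
      refine ⟨?_, hr'⟩
      -- Neither `ψ` nor the distance is known to be continuous here; the local bound at the limit
      -- point `r` itself replaces continuity.
      have h1 : ∃ᶠ r' in 𝓝 r, r' ∈ K ∩ Icc (s : ℝ) t := mem_closure_iff_frequently.1 hr
      have h2 := eventually_nhdsWithin_iff.1 (hloc r hr')
      have h3 : Tendsto (fun r' => ENNReal.ofReal (r' - s) + ENNReal.ofReal |r' - r|) (𝓝 r)
          (𝓝 (ENNReal.ofReal (r - s) + ENNReal.ofReal |r - r|)) := by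
        apply Continuous.tendsto
        exact (ENNReal.continuous_ofReal.comp (by fun_prop)).add
          (ENNReal.continuous_ofReal.comp (by fun_prop))
      simp only [sub_self, abs_zero, ENNReal.ofReal_zero, add_zero] at h3
      refine ge_of_tendsto_of_frequently h3 ((h1.and_eventually h2).mono fun r' hh => ?_)
      exact (TropicalCurve.edist_triangle _ (ψ (γ r')) _).trans (add_le_add hh.1.1 (hh.2 hh.1.2))
    · simp [hK, TropicalCurve.edist_self]
    · rintro r ⟨hrK, hr⟩
      have h1 : 𝓝[>] r ≤ 𝓝[Icc (s : ℝ) t] r := by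
        rw [← nhdsWithin_Ioc_eq_nhdsGT hr.2]
        exact nhdsWithin_mono _ (Ioc_subset_Icc_self.trans (Icc_subset_Icc_left hr.1))
      filter_upwards [h1 (hloc r (Ico_subset_Icc_self hr)), self_mem_nhdsWithin] with r' h2 h3
      have h3 : r < r' := h3
      rw [TropicalCurve.edist_comm, abs_of_nonneg (sub_nonneg.2 h3.le)] at h2
      refine (TropicalCurve.edist_triangle _ (ψ (γ r)) _).trans ((add_le_add hrK h2).trans ?_)
      rw [← ENNReal.ofReal_add (sub_nonneg.2 hr.1) (sub_nonneg.2 h3.le)]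
      simp
  have h1 : (s : ℝ) ≤ t := by exact_mod_cast hst
  have h2 : (t : ℝ) ∈ K := hsub (right_mem_Icc.2 h1)
  simp only [hK, hγ, mem_ofPred_eq, ENNReal.ofReal_coe_nnreal] at h2
  refine h2.trans (le_trans (le_of_eq ?_) le_add_self)
  rw [ENNReal.ofReal_sub _ s.coe_nonneg]
  simp

/-- A homeomorphism that induces a bijection of rational functions does not increase distances. -/
lemma edist_map_le_of_ratFunctions (ψ : X ≃ₜ Y)
    (h : ∀ f : Y → EReal, f ∘ ψ ∈ ratFunctions X ↔ f ∈ ratFunctions Y) (x y : X) :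
    edist (ψ x) (ψ y) ≤ edist x y := by
  refine edist_map_le_of_eventually ψ (fun p hp => ?_) x y
  have hp' : ψ p ∉ pointsAtInfinity Y := by
    -- Otherwise a rational function equal to `⊤` at `ψ p` would pull back to one equal to `⊤` at
    -- the finite point `p`.
    rintro ⟨N, hN, e, he, hpe⟩
    obtain ⟨f, hf, hf'⟩ := hN.exists_ratFunction_eq_top he
    have h1 : (f ∘ ψ) p = ⊤ := (hf' _).2 hpe.symm
    exact notMem_pointsAtInfinity_of_ratFunction ((h f).2 hf) (x₀ := p) (by rw [h1]; simp) hp h1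
  obtain ⟨f, hf, hf0, -, hfev⟩ := exists_ratFunction_edist hp'
  obtain ⟨g, hg, hg0, -, hgev⟩ := exists_ratFunction_edist hp
  have hg' : g ∘ ψ.symm ∈ ratFunctions Y := by
    rw [← h]
    convert hg
    ext z
    simp
  have h1 := eventually_eq_int_mul_edist hp ((h f).2 hf) hf0
  have h2 := eventually_eq_int_mul_edist hp' hg' (by simp [hg0])
  have hψ := ψ.continuous.continuousAt (x := p)
  filter_upwards [h1, hψ.eventually h2, hψ.eventually hfev, hgev,
    Model.eventually_edist_lt hp ENNReal.zero_lt_top,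
    hψ.eventually (Model.eventually_edist_lt hp' ENNReal.zero_lt_top)]
    with z h1 h2 h3 h4 h5 h6
  obtain ⟨k, h1⟩ := h1
  obtain ⟨k', h2⟩ := h2
  simp only [Function.comp_apply, ψ.symm_apply_apply] at h1 h2
  rw [h3, EReal.coe_eq_coe_iff] at h1
  rw [h4, EReal.coe_eq_coe_iff] at h2
  rw [← ENNReal.toReal_le_toReal h6.ne h5.ne]
  have hd : 0 ≤ (edist z p).toReal := ENNReal.toReal_nonneg
  generalize (edist z p).toReal = d at *
  generalize (edist (ψ z) (ψ p)).toReal = d' at *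
  obtain rfl | hd0 := hd.eq_or_lt
  · simp [h1]
  -- Here `d' = k * d` and `d = k' * d'` with `d > 0`, so the integers `k` and `k'` are both `1` or
  -- both `-1`.
  have h7 : ((k' * k : ℤ) : ℝ) = 1 := by
    push_cast
    have : (k' * k - 1 : ℝ) * d = 0 := by rw [sub_mul, one_mul, mul_assoc, ← h1, ← h2, sub_self]
    linarith [(mul_eq_zero.1 this).resolve_right hd0.ne']
  have h8 : k' * k = 1 := by exact_mod_cast h7
  obtain rfl | rfl := Int.eq_one_or_neg_one_of_mul_eq_one' (by rwa [mul_comm] at h8) |>.imp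
    And.left And.left
  · simp [h1]
  · rw [h1]; push_cast; linarith

end isometry

/-! ### Transport along isometric homeomorphisms -/

namespace Model

section map

variable {X : Type u} {Y : Type v}

/-- The transport of a model along a homeomorphism. -/
def map [TopologicalSpace X] [TopologicalSpace Y] (M : Model X) (ψ : X ≃ₜ Y) : Model Y where
  V := M.V.map ψ.toEquiv.toEmbedding
  E := M.E
  fintypeE := M.fintypeE
  len := M.len
  param e t := ψ (M.param e t)
  len_pos := M.len_pos
  continuousOn_param e := ψ.continuous.comp_continuousOn (M.continuousOn_param e)
  param_zero_mem e := Finset.mem_map_of_mem _ (M.param_zero_mem e)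
  param_len_mem e := Finset.mem_map_of_mem _ (M.param_len_mem e)
  interior_notMem e t h0 h1 h := M.interior_notMem e t h0 h1 ((Finset.mem_map' _).1 h)
  interior_inj e t h0 h1 e' t' h' h := M.interior_inj e t h0 h1 e' t' h' (ψ.injective h)
  leaf_of_len_eq_top e he e' t' h' h := M.leaf_of_len_eq_top e he e' t' h' (ψ.injective h)
  cover y := by
    obtain h | ⟨e, t, ht, h⟩ := M.cover (ψ.symm y)
    · exact .inl (Finset.mem_map.2 ⟨_, h, ψ.apply_symm_apply y⟩)
    · exact .inr ⟨e, t, ht, by rw [h, ψ.apply_symm_apply]⟩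

lemma edge_map [TopologicalSpace X] [TopologicalSpace Y] (M : Model X) (ψ : X ≃ₜ Y) (e : M.E) :
    (M.map ψ).edge e = ψ '' M.edge e :=
  image_comp ψ (M.param e) _

lemma pathDist_map [TopologicalSpace X] [TopologicalSpace Y] (M : Model X) (ψ : X ≃ₜ Y) (x y : X) :
    (M.map ψ).pathDist (ψ x) (ψ y) = M.pathDist x y := by
  apply le_antisymm
  · exact M.le_pathDist_of_le (fun x y => (M.map ψ).pathDist (ψ x) (ψ y))
      (fun _ => pathDist_self _ _) (fun _ _ _ => pathDist_triangle _ _ _ _)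
      (fun e s t hs ht => (M.map ψ).pathDist_param_le e hs ht) x y
  · have := (M.map ψ).le_pathDist_of_le (fun x y => M.pathDist (ψ.symm x) (ψ.symm y))
      (fun _ => pathDist_self _ _) (fun _ _ _ => pathDist_triangle _ _ _ _)
      (fun e s t hs ht => by
        have := M.pathDist_param_le e hs ht
        rwa [← ψ.symm_apply_apply (M.param e s), ← ψ.symm_apply_apply (M.param e t)] at this)
      (ψ x) (ψ y)
    simpa using this

variable [TropicalCurve X] [TropicalCurve Y] {ψ : X ≃ₜ Y}

lemma IsModelFor.map {M : Model X} (hM : M.IsModelFor)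
    (hψ : ∀ x y, edist (ψ x) (ψ y) = edist x y) : (M.map ψ).IsModelFor := by
  intro x y
  obtain ⟨x, rfl⟩ := ψ.surjective x
  obtain ⟨y, rfl⟩ := ψ.surjective y
  rw [pathDist_map, hM, hψ]

end map

end Model

section

variable {X : Type u} {Y : Type v} [TropicalCurve X] [TropicalCurve Y] {ψ : X ≃ₜ Y}

lemma map_mem_pointsAtInfinity (hψ : ∀ x y, edist (ψ x) (ψ y) = edist x y) {x : X}
    (hx : x ∈ pointsAtInfinity X) : ψ x ∈ pointsAtInfinity Y := by
  obtain ⟨M, hM, e, he, rfl⟩ := hx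
  exact ⟨M.map ψ, hM.map hψ, e, he, rfl⟩

lemma edist_symm (hψ : ∀ x y, edist (ψ x) (ψ y) = edist x y) (x y : Y) :
    edist (ψ.symm x) (ψ.symm y) = edist x y := by
  rw [← hψ, ψ.apply_symm_apply, ψ.apply_symm_apply]

lemma comp_mem_ratFunctions (hψ : ∀ x y, edist (ψ x) (ψ y) = edist x y) {f : Y → EReal}
    (hf : f ∈ ratFunctions Y) : f ∘ ψ ∈ ratFunctions X := by
  obtain ⟨hc, hfin, M, hM, haff⟩ | rfl := hf
  · refine .inl ⟨hc.comp ψ.continuous, fun x hx => hfin _ fun h => hx ?_,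
      M.map ψ.symm, hM.map (edist_symm hψ), fun e => ?_⟩
    · simpa using map_mem_pointsAtInfinity (edist_symm hψ) h
    · obtain ⟨m, c, h⟩ := haff e
      refine ⟨m, c, fun t ht => ?_⟩
      rw [← h t ht]
      exact congrArg f (ψ.apply_symm_apply _)
  · exact .inr rfl

/-- With the transported model on the target, edges correspond to themselves with degree one, and
every sum in the definition has exactly one term. -/
lemma isFiniteHarmonicOfDegree_one_of_isometry (hψ : ∀ x y, edist (ψ x) (ψ y) = edist x y)
    {M : Model X} (hM : M.IsModelFor) (hl : M.Loopless) : IsFiniteHarmonicOfDegree ψ 1 := by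
  classical
  have hsum : ∀ (x : X) (e' : M.E), ψ x ∈ (M.map ψ).edge e' →
      ∑ e : M.E with e = e' ∧ x ∈ M.edge e, 1 = 1 := by
    intro x e' h
    rw [Model.edge_map, ψ.injective.mem_set_image] at h
    rw [Finset.sum_const, smul_eq_mul, mul_one, Finset.card_eq_one]
    refine ⟨e', ?_⟩
    ext e
    simp only [Finset.mem_filter, Finset.mem_univ, true_and, Finset.mem_singleton]
    exact ⟨fun h => h.1, fun h' => ⟨h', h' ▸ h⟩⟩
  let H : HarmonicModels ψ :=
    { M := M
      M' := M.map ψ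
      isModelFor := hM
      isModelFor' := hM.map hψ
      loopless := hl
      loopless' := fun e h => hl e (ψ.injective h)
      map_vertex := fun x hx => Finset.mem_map_of_mem _ hx
      edgeMap := fun e => e
      image_edge := fun e => (M.edge_map ψ e).symm
      edgeDeg := fun _ => 1
      edgeDeg_pos := fun _ => one_pos
      edist_map := fun e x _ y _ => by simp [hψ]
      harmonic := fun x _ e₁ e₂ h₁ h₂ => by
        convert (hsum x e₁ h₁).trans (hsum x e₂ h₂).symm <;> exact Iff.rfl }
  refine ⟨⟨ψ.continuous, ⟨H⟩, fun h => ψ.toEquiv.symm.subsingleton⟩, H, fun _ => 1, ?_, ?_⟩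
  · intro x _ e' h
    convert hsum x e' h
    exact Iff.rfl
  · intro y hy
    obtain ⟨x, hx, rfl⟩ := Finset.mem_map.1 hy
    rw [Finset.sum_const, smul_eq_mul, mul_one, Finset.card_eq_one]
    refine ⟨x, ?_⟩
    ext z
    simp only [Finset.mem_filter, Finset.mem_singleton]
    exact ⟨fun h => ψ.injective h.2, by rintro rfl; exact ⟨hx, rfl⟩⟩

end

/-! ### Surjectivity, and morphisms of degree one -/

lemma Model.eq_or_eq_of_mem_edge {X : Type u} [TopologicalSpace X] (M : Model X) {x : X}
    (hx : x ∈ M.V) {e : M.E} (h : x ∈ M.edge e) : x = M.param e 0 ∨ x = M.param e (M.len e) := by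
  obtain ⟨t, ht, rfl⟩ := h
  obtain rfl | rfl := M.eq_zero_or_eq_len e ht hx <;> simp

namespace HarmonicModels

variable {Γ : Type u} {Γ' : Type v} [TropicalCurve Γ] [TropicalCurve Γ'] {φ : Γ → Γ'}
  (H : HarmonicModels φ)

lemma map_mem_edge {e : H.M.E} {x : Γ} (hx : x ∈ H.M.edge e) : φ x ∈ H.M'.edge (H.edgeMap e) :=
  H.image_edge e ▸ mem_image_of_mem φ hx

lemma injOn_edge (e : H.M.E) : InjOn φ (H.M.edge e) := by
  intro x hx y hy h
  have h1 := H.edist_map e x hx y hy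
  rw [h, TropicalCurve.edist_self, eq_comm, mul_eq_zero] at h1
  exact Model.eq_of_edist_eq_zero
    (h1.resolve_left (by exact_mod_cast (H.edgeDeg_pos e).ne'))

/-- Each end of the image of an edge is the image of an end. -/
lemma exists_vertex_of_mem_edge (e : H.M.E) {y : Γ'} (hy : y ∈ H.M'.V)
    (hy' : y ∈ H.M'.edge (H.edgeMap e)) : ∃ x ∈ H.M.V, x ∈ H.M.edge e ∧ φ x = y := by
  by_contra! hc
  have h0 := H.M.param_mem_edge e (zero_le (a := H.M.len e))
  have h1 := H.M.param_mem_edge e (le_refl (H.M.len e))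
  -- The two ends have distinct images, both ends of the image edge, so they exhaust its ends.
  have hne : φ (H.M.param e 0) ≠ φ (H.M.param e (H.M.len e)) := fun h =>
    H.loopless e (H.injOn_edge e h0 h1 h)
  have h2 := hc _ (H.M.param_zero_mem e) h0
  have h3 := hc _ (H.M.param_len_mem e) h1
  have h4 := H.M'.eq_or_eq_of_mem_edge hy hy'
  have h5 := H.M'.eq_or_eq_of_mem_edge (H.map_vertex _ (H.M.param_zero_mem e)) (H.map_mem_edge h0)
  have h6 := H.M'.eq_or_eq_of_mem_edge (H.map_vertex _ (H.M.param_len_mem e)) (H.map_mem_edge h1)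
  grind

/-- An interior point over a vertex would share its image with an end of its edge, against
injectivity on edges. -/
lemma mem_V_of_map_mem_V {x : Γ} (h : φ x ∈ H.M'.V) : x ∈ H.M.V := by
  by_contra hx
  obtain ⟨e, t, h0, h1, rfl⟩ := H.M.mem_edge_of_notMem x hx
  have hmem := H.M.param_mem_edge e h1.le
  obtain ⟨w, hw, hwe, h2⟩ := H.exists_vertex_of_mem_edge e h (H.map_mem_edge hmem)
  exact hx (H.injOn_edge e hwe hmem h2 ▸ hw)

open Classical in
lemma edgeDeg_le_sum {e : H.M.E} {x : Γ} (hx : x ∈ H.M.edge e) :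
    H.edgeDeg e ≤ ∑ e₁ with H.edgeMap e₁ = H.edgeMap e ∧ x ∈ H.M.edge e₁, H.edgeDeg e₁ :=
  Finset.single_le_sum (f := H.edgeDeg) (fun _ _ => Nat.zero_le _) (by simp [hx])

/-- Over a vertex, some edge at `x` makes one of the harmonic sums positive; all of them are then
positive, hence nonempty. -/
lemma mem_range_edgeMap [Nontrivial Γ] {x : Γ} {e' : H.M'.E} (h : φ x ∈ H.M'.edge e') :
    e' ∈ range H.edgeMap := by
  classical
  obtain ⟨e, he⟩ := H.M.exists_mem_edge x
  by_cases hV : φ x ∈ H.M'.V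
  · have hx := H.mem_V_of_map_mem_V hV
    have h1 := H.harmonic x hx _ e' (H.map_mem_edge he) h
    have h2 : 0 < ∑ e with H.edgeMap e = e' ∧ x ∈ H.M.edge e, H.edgeDeg e := by
      rw [← h1]
      exact (H.edgeDeg_pos e).trans_le (H.edgeDeg_le_sum he)
    obtain ⟨e₁, h3, -⟩ := Finset.exists_ne_zero_of_sum_ne_zero h2.ne'
    exact ⟨e₁, (Finset.mem_filter.1 h3).2.1⟩
  · exact ⟨e, H.M'.eq_of_mem_edge hV h (H.map_mem_edge he)⟩

end HarmonicModels

section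

variable {Γ : Type u} {Γ' : Type v} [TropicalCurve Γ] [TropicalCurve Γ'] {φ : Γ → Γ'}

/-- The image is clopen: it is compact, and since it contains every edge it meets, its complement is
a finite union of vertices and edges. -/
lemma IsFiniteHarmonic.surjective (h : IsFiniteHarmonic φ) : Function.Surjective φ := by
  obtain ⟨hc, ⟨H⟩, hs⟩ := h
  obtain hΓ | hΓ := subsingleton_or_nontrivial Γ
  · have := hs hΓ
    intro y
    obtain ⟨x⟩ : Nonempty Γ := inferInstance
    exact ⟨x, Subsingleton.elim _ _⟩
  rw [← range_eq_univ]
  have hedge : ∀ e' x, φ x ∈ H.M'.edge e' → H.M'.edge e' ⊆ range φ := by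
    intro e' x hx
    obtain ⟨e, rfl⟩ := H.mem_range_edgeMap hx
    rw [← H.image_edge]
    exact image_subset_range _ _
  have hclosed : IsClosed (range φ)ᶜ := by
    have : (range φ)ᶜ = (↑H.M'.V \ range φ) ∪
        ⋃ e' : {e' // Disjoint (H.M'.edge e') (range φ)}, H.M'.edge e' := by
      ext y
      simp only [mem_compl_iff, mem_union, Set.mem_sdiff, Finset.mem_coe, mem_iUnion]
      constructor
      · intro hy
        obtain h | ⟨e, t, ht, rfl⟩ := H.M'.cover y
        · exact .inl ⟨h, hy⟩
        · refine .inr ⟨⟨e, ?_⟩, H.M'.param_mem_edge e ht⟩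
          rw [Set.disjoint_left]
          rintro _ h ⟨x, rfl⟩
          exact hy (hedge e x h (H.M'.param_mem_edge e ht))
      · rintro (h | ⟨⟨e, he⟩, h⟩)
        · exact h.2
        · exact Set.disjoint_left.1 he h
    rw [this]
    exact ((H.M'.V.finite_toSet.subset sdiff_subset).isClosed).union
      (isClosed_iUnion_of_finite fun e => H.M'.isClosed_edge e)
  have hclopen : IsClopen (range φ) :=
    ⟨(isCompact_range hc).isClosed, isClosed_compl_iff.1 hclosed⟩
  exact hclopen.eq_univ (range_nonempty φ)

/-- A finite harmonic morphism of degree one is an isometric homeomorphism. -/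
lemma IsFiniteHarmonicOfDegree.exists_homeomorph (h : IsFiniteHarmonicOfDegree φ 1) :
    ∃ ψ : Γ ≃ₜ Γ', ⇑ψ = φ ∧ ∀ x y, edist (φ x) (φ y) = edist x y := by
  classical
  obtain ⟨hφ, H, d, hd, hsum⟩ := h
  have hsurj := hφ.surjective
  suffices hh : Function.Injective φ ∧ ∀ x y, edist (φ x) (φ y) = edist x y by
    let ε := Equiv.ofBijective φ ⟨hh.1, hsurj⟩
    exact ⟨Continuous.homeoOfEquivCompactToT2 (f := ε) hφ.1, rfl, hh.2⟩
  obtain hΓ | hΓ := subsingleton_or_nontrivial Γ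
  · refine ⟨Function.injective_of_subsingleton φ, fun x y => ?_⟩
    rw [Subsingleton.elim x y, TropicalCurve.edist_self, TropicalCurve.edist_self]
  have hdeg : ∀ x ∈ H.M.V, ∀ e, x ∈ H.M.edge e → H.edgeDeg e ≤ d x := by
    intro x hx e he
    rw [← hd x hx _ (H.map_mem_edge he)]
    exact H.edgeDeg_le_sum he
  have hpos : ∀ x ∈ H.M.V, 1 ≤ d x := by
    intro x hx
    obtain ⟨e, he⟩ := H.M.exists_mem_edge x
    exact (H.edgeDeg_pos e).trans_le (hdeg x hx e he)
  have hle : ∀ x ∈ H.M.V, d x ≤ 1 := by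
    intro x hx
    rw [← hsum _ (H.map_vertex x hx)]
    exact Finset.single_le_sum (f := d) (fun _ _ => Nat.zero_le _) (by simp [hx])
  -- Every vertex degree is at least 1, so two vertices in one fibre would make the degree at least
  -- 2.
  have hV : ∀ x ∈ H.M.V, ∀ y ∈ H.M.V, φ x = φ y → x = y := by
    intro x hx y hy hxy
    by_contra hne
    have h1 := Finset.add_le_sum (f := d) (s := H.M.V.filter (φ · = φ y))
      (fun _ _ => Nat.zero_le _) (i := x) (j := y) (by simp [hx, hxy]) (by simp [hy]) hne
    rw [hsum _ (H.map_vertex y hy)] at h1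
    have := hpos x hx
    have := hpos y hy
    omega
  have hdeg1 : ∀ e, H.edgeDeg e = 1 := fun e =>
    le_antisymm ((hdeg _ (H.M.param_zero_mem e) e (H.M.param_mem_edge e zero_le)).trans
      (hle _ (H.M.param_zero_mem e))) (H.edgeDeg_pos e)
  -- By `hV`, two edges with the same image share an end `x`, and both would count towards `d x ≤
  -- 1`.
  have hinjE : ∀ e₁ e₂, H.edgeMap e₁ = H.edgeMap e₂ → e₁ = e₂ := by
    intro e₁ e₂ h12
    by_contra hne
    have h0 := H.M.param_mem_edge e₁ (zero_le (a := H.M.len e₁))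
    have h0V := H.M.param_zero_mem e₁
    generalize H.M.param e₁ 0 = x at h0 h0V
    obtain ⟨x₂, hx₂, hx₂e, hx₂'⟩ := H.exists_vertex_of_mem_edge e₂ (H.map_vertex x h0V)
      (h12 ▸ H.map_mem_edge h0)
    rw [hV _ hx₂ _ h0V hx₂'] at hx₂e
    have h1 := Finset.add_le_sum (f := H.edgeDeg)
      (s := Finset.univ.filter fun e => H.edgeMap e = H.edgeMap e₁ ∧ x ∈ H.M.edge e)
      (fun _ _ => Nat.zero_le _) (i := e₁) (j := e₂) (by simp [h0]) (by simp [hx₂e, h12]) hne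
    rw [hd x h0V _ (H.map_mem_edge h0), hdeg1, hdeg1] at h1
    have := hle x h0V
    omega
  have hinj : Function.Injective φ := by
    intro x y hxy
    by_cases hx : φ x ∈ H.M'.V
    · exact hV _ (H.mem_V_of_map_mem_V hx) _ (H.mem_V_of_map_mem_V (hxy ▸ hx)) hxy
    · obtain ⟨e₁, h1⟩ := H.M.exists_mem_edge x
      obtain ⟨e₂, h2⟩ := H.M.exists_mem_edge y
      obtain rfl := hinjE _ _ (H.M'.eq_of_mem_edge hx (hxy ▸ H.map_mem_edge h2) (H.map_mem_edge h1))
      exact H.injOn_edge _ h1 h2 hxy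
  have hedge : ∀ e, ∀ x ∈ H.M.edge e, ∀ y ∈ H.M.edge e, edist (φ x) (φ y) = edist x y := by
    intro e x hx y hy
    rw [H.edist_map e x hx y hy, hdeg1, Nat.cast_one, one_mul]
  refine ⟨hinj, fun x y => le_antisymm ?_ ?_⟩
  · rw [← H.isModelFor]
    refine H.M.le_pathDist_of_le (fun x y => edist (φ x) (φ y))
      (fun _ => TropicalCurve.edist_self _) (fun _ _ _ => TropicalCurve.edist_triangle _ _ _)
      (fun e s t hs ht => ?_) x y
    rw [hedge e _ (H.M.param_mem_edge e hs) _ (H.M.param_mem_edge e ht)]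
    exact H.isModelFor.edist_param_le e hs ht
  -- The inverse is tested on edges of the target, each of which is the isometric image of an edge
  -- of the source.
  · rw [← H.isModelFor']
    have := H.M'.le_pathDist_of_le
      (fun x y => edist (Function.surjInv hsurj x) (Function.surjInv hsurj y))
      (fun _ => TropicalCurve.edist_self _) (fun _ _ _ => TropicalCurve.edist_triangle _ _ _)
      (fun e' s t hs ht => ?_) (φ x) (φ y)
    · simpa only [Function.leftInverse_surjInv ⟨hinj, hsurj⟩ _] using this
    · have hs' := H.M'.param_mem_edge e' hs
      have ht' := H.M'.param_mem_edge e' ht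
      have h1 := H.isModelFor'.edist_param_le e' hs ht
      obtain ⟨e, rfl⟩ : e' ∈ range H.edgeMap := by
        obtain ⟨x, hx⟩ := hsurj (H.M'.param e' s)
        exact H.mem_range_edgeMap (hx ▸ hs')
      rw [← H.image_edge] at hs' ht'
      obtain ⟨a, ha, ha'⟩ := hs'
      obtain ⟨b, hb, hb'⟩ := ht'
      rw [← ha', ← hb'] at h1 ⊢
      rw [hedge e a ha b hb] at h1
      simpa only [Function.leftInverse_surjInv ⟨hinj, hsurj⟩ _] using h1

end

/-! ### Comparison of pull-backs -/

section

variable {Γ : Type u} {Γ₁ : Type v} {Γ₂ : Type w} [TropicalCurve Γ₁] [TropicalCurve Γ₂]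
  {φ₁ : Γ → Γ₁} {φ₂ : Γ → Γ₂}

lemma mem_pullback_iff (h : Function.Surjective φ₁) {f : Γ₁ → EReal} :
    f ∘ φ₁ ∈ pullback φ₁ ↔ f ∈ ratFunctions Γ₁ :=
  h.injective_comp_right.mem_set_image

lemma eq_of_pullback_subset (h : pullback φ₁ ⊆ pullback φ₂) {x y : Γ} (hxy : φ₂ x = φ₂ y) :
    φ₁ x = φ₁ y := by
  by_contra hne
  obtain ⟨f, hf, hf'⟩ := exists_ratFunction_ne hne
  obtain ⟨g, -, hg⟩ := h ⟨f, hf, rfl⟩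
  have h1 := congrFun hg x
  have h2 := congrFun hg y
  simp only [Function.comp_apply, hxy] at h1 h2
  exact hf' (h1.symm.trans h2)

end

theorem mainTheorem3 {Γ : Type u} {Γ₁ : Type v} {Γ₂ : Type w}
    [TropicalCurve Γ] [TropicalCurve Γ₁] [TropicalCurve Γ₂]
    (φ₁ : Γ → Γ₁) (φ₂ : Γ → Γ₂) (h₁ : IsFiniteHarmonic φ₁) (h₂ : IsFiniteHarmonic φ₂) :
    pullback φ₁ = pullback φ₂ ↔
      ∃ φ₁₂ : Γ₂ → Γ₁, IsFiniteHarmonicOfDegree φ₁₂ 1 ∧ φ₁ = φ₁₂ ∘ φ₂ := by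
  constructor
  · intro h
    have hs₁ := h₁.surjective
    have hs₂ := h₂.surjective
    -- The choice of preimages is immaterial, as `φ₁` is constant on the fibres of `φ₂`.
    let ψ : Γ₂ → Γ₁ := φ₁ ∘ Function.surjInv hs₂
    have hψ : ∀ x, ψ (φ₂ x) = φ₁ x := fun x =>
      eq_of_pullback_subset h.subset (Function.surjInv_eq hs₂ _)
    have hcomp : ψ ∘ φ₂ = φ₁ := funext hψ
    have hbij : Function.Bijective ψ := by
      refine ⟨fun a b hab => ?_, fun y => ?_⟩
      · obtain ⟨x, rfl⟩ := hs₂ a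
        obtain ⟨y, rfl⟩ := hs₂ b
        rw [hψ, hψ] at hab
        exact eq_of_pullback_subset h.symm.subset hab
      · obtain ⟨x, rfl⟩ := hs₁ y
        exact ⟨φ₂ x, hψ x⟩
    have hcont : Continuous ψ := by
      -- A continuous surjection from a compact space to a Hausdorff space is a quotient map.
      rw [(h₂.1.isClosedMap.isQuotientMap h₂.1 hs₂).continuous_iff, hcomp]
      exact h₁.1
    obtain ⟨Ψ, hΨ⟩ : ∃ Ψ : Γ₂ ≃ₜ Γ₁, ⇑Ψ = ψ :=
      ⟨Continuous.homeoOfEquivCompactToT2 (f := Equiv.ofBijective ψ hbij) hcont, rfl⟩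
    have hΨφ : Ψ ∘ φ₂ = φ₁ := hΨ ▸ hcomp
    have hrat : ∀ f : Γ₁ → EReal, f ∘ Ψ ∈ ratFunctions Γ₂ ↔ f ∈ ratFunctions Γ₁ := by
      intro f
      rw [← mem_pullback_iff h₁.surjective, ← mem_pullback_iff h₂.surjective, h,
        Function.comp_assoc, hΨφ]
    have hiso : ∀ x y, edist (Ψ x) (Ψ y) = edist x y := fun x y => by
      refine le_antisymm (edist_map_le_of_ratFunctions Ψ hrat x y) ?_
      have := edist_map_le_of_ratFunctions Ψ.symm
        (fun f => by rw [← hrat, Function.comp_assoc, Ψ.symm_comp_self, Function.comp_id])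
        (Ψ x) (Ψ y)
      simpa using this
    -- The harmonic structure on `φ₂` supplies the loopless model of `Γ₂`.
    obtain ⟨-, ⟨H⟩, -⟩ := h₂
    exact ⟨Ψ, isFiniteHarmonicOfDegree_one_of_isometry hiso H.isModelFor' H.loopless', hΨφ.symm⟩
  · rintro ⟨φ₁₂, hφ, rfl⟩
    obtain ⟨ψ, rfl, hψ⟩ := hφ.exists_homeomorph
    ext f
    constructor
    · rintro ⟨g, hg, rfl⟩
      exact ⟨g ∘ ψ, comp_mem_ratFunctions hψ hg, rfl⟩
    · rintro ⟨g, hg, rfl⟩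
      refine ⟨g ∘ ψ.symm, comp_mem_ratFunctions (edist_symm hψ) hg, ?_⟩
      ext x
      simp
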